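/- **Setting.** A state is a vector $\bar x=(x_O,x_A,x_B,x_{AB},x_{BA})\in(\mathbb R^5)^+$ of fluid levels. For $\gamma>0$, $x_0\ge 0$ and a net inflow $Y:[0,\infty)\to[0,\infty)$ (non-decreasing, Lipschitz, $Y(0)=0$) let $$W(\gamma,x_0,Y)(t)=V(t)+U(t),\qquad V(t)=x_0+Y(t)-\gamma t,\qquad U(t)=\max\{0,-\inf_{s\in[0,t]}V(s)\}.$$ Given net inflows $\bar Y=(Y_O,Y_A,Y_B,Y_{AB},Y_{BA})$, the dynamics $\Delta(\bar Y)$ started from $\bar x(0)$ is $$x_O(\cdot)=W(3,x_O(0),Y_O),\qquad x_{BA}(\cdot)=W(2,x_{BA}(0),Y_{BA}),$$ $$x_A(\cdot)=W(10,\,5x_{BA}(0)+x_A(0),\,5Y_{BA}+Y_A)-5x_{BA}(\cdot),$$ with the symmetric equations (exchange $A\leftrightarrow B$, $AB\leftrightarrow BA$) for $x_{AB},x_B$. The net outflows are $\bar Z^{\bar x,\bar Y}(t)=\bar x(0)+\bar Y(t)-\bar x(t)$. For a probability measure $\mu_0$ on $(\mathbb R^5)^+$, let $\mathcal Y(\mu_0)$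 be the set of all net inflows $\bar Y$ such that for all $t\ge 0$ $$Y_O=\int (Z_{AB}^{\bar x,\bar Y}+Z_{BA}^{\bar x,\bar Y})\,d\mu_0(\bar x),\quad Y_A=Y_B=\tfrac12\int Z_O^{\bar x,\bar Y}\,d\mu_0(\bar x),\quad Y_{AB}=\int Z_A^{\bar x,\bar Y}\,d\mu_0(\bar x),\quad Y_{BA}=\int Z_B^{\bar x,\bar Y}\,d\mu_0(\bar x).$$ For $\bar Y\in\mathcal Y(\mu_0)$, the corresponding $\Delta_\infty$ trajectory is the family $\mu(t)$ of images of $\mu(0)=\mu_0$ under $\Delta(\bar Y)$ at times $t\ge 0$. The cycle $\mathcal C$ consists of the points with $x_O=x_{BA}=0$, $x_A=\max(1-9t,0)$, $x_B=t$, $x_{AB}=\min(8t,1-t)$, $t\in[0,1]$, and of their images under $A\leftrightarrow B$, $AB\leftrightarrow BA$. The distance $\rho_{KROV}(\mu,\nu)$ is the infimum of $\int\rho\,d\kappa$ over all couplings $\kappa$ of $\mu$ and $\nu$, where $\rho(\bar x,\bar y)=\sum_i|x_i-y_i|$. Let $m(\bar x)=\max\{\frac12x_{AB}+\frac1{10}x_B,\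 \frac12x_{BA}+\frac1{10}x_A,\ \frac13x_O\}$, $\mathcal K=\{\bar x\in(\mathbb R^5)^+: m(\bar x)<10\}$, and let $L=0$ on $\mathcal K$, $L=m$ off $\mathcal K$. Write $\langle f\rangle_\mu=\int f\,d\mu$. **Proposition 4.6.** For all $\alpha>0$ and $A<\infty$ there is $\varepsilon>0$ (depending on $\alpha$ and $A$) such that the following holds. Let $\mu(0)$ be a probability measure on $(\mathbb R^5)^+$ with i) $\int (x_A+x_B+x_{BA}+x_{AB}+x_O)\,d\mu(0)=1$; ii) $\langle\exp(\alpha L)\rangle_{\mu(0)}<3A$; iii) $\rho_{KROV}(\mu(0),\delta_x)<\varepsilon$ for some $x\in\mathcal C$. Let $\bar Y\in\mathcal Y(\mu(0))$ and let $\mu(t)$ be the corresponding $\Delta_\infty$ trajectory. Then, as $t\to\infty$, I) $\rho_{KROV}(\mu(t),\delta_{z(t)})\to 0$ for an appropriate $z(t)\in\mathcal C$; II) $\langle\exp(\alpha L)\,\mathbf 1_{\mathcal K^c}\rangle_{\mu(t)}\to 0$, and hence $\langle\exp(\alpha L)\rangle_{\mu(t)}\to 1$ (its minimal possible value). Moreover,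 the convergence in I) and II) is uniform over all $\bar Y\in\mathcal Y(\mu(0))$ and all $\mu(0)$ satisfying i)–iii). -/

import Mathlib

open MeasureTheory Filter Topology
open scoped ENNReal

noncomputable section

namespace FluidNetwork

/-- The five fluids of the basic network. Fluid `O` sits at the node `Ō`; fluids `A` (light) and
`BA` (heavy, with priority) sit at the node `Ā`; fluids `B` (light) and `AB` (heavy, with priority)
sit at the node `B̄`. The routes are `O → A → AB → O` and `O → B → BA → O`. -/
inductive Fluid
  | O | A | B | AB | BA
  deriving DecidableEq

instance : Fintype Fluid :=
  ⟨{.O, .A, .B, .AB, .BA}, fun i => by cases i <;> decide⟩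

/-- Vectors of fluid levels. The physical states are those in `orthant`. -/
abbrev State := Fluid → ℝ

/-- The positive orthant `(ℝ⁵)⁺`. -/
def orthant : Set State := {x | ∀ i, 0 ≤ x i}

/-- The metric `ρ(x, y) = ∑ |xᵢ - yᵢ|`. -/
def rho (x y : State) : ℝ := ∑ i, |x i - y i|

/-- The Kantorovich-Rubinstein-Ornstein-Vaserstein distance: the infimum of `∫ ρ dκ` over all
couplings `κ` of the two measures. -/
def krov (μ ν : Measure State) : ℝ≥0∞ :=
  ⨅ (κ : Measure (State × State)) (_ : κ.map Prod.fst = μ ∧ κ.map Prod.snd = ν),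
    ∫⁻ p, ENNReal.ofReal (rho p.1 p.2) ∂κ

/-! ### A single node with one fluid -/

/-- The virtual level `V(t) = x(0) + Y(t) - γ t`. -/
def virtualLevel (γ x₀ : ℝ) (Y : ℝ → ℝ) (t : ℝ) : ℝ := x₀ + Y t - γ * t

/-- The unused service capacity `U(t) = max {0, - inf_{s ∈ [0,t]} V(s)}`. -/
def unusedCapacity (γ x₀ : ℝ) (Y : ℝ → ℝ) (t : ℝ) : ℝ :=
  max 0 (-sInf (virtualLevel γ x₀ Y '' Set.Icc 0 t))

/-- The level `W(γ, x(0), Y)(t) = V(t) + U(t)` of the fluid in a work-conserving node of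
capacity `γ`, with initial level `x₀` and net inflow `Y`. -/
def W (γ x₀ : ℝ) (Y : ℝ → ℝ) (t : ℝ) : ℝ := virtualLevel γ x₀ Y t + unusedCapacity γ x₀ Y t

/-! ### The open system driven by a given net inflow -/

/-- `Y i t` is the amount of fluid `i` that enters the system during `[0, t]`: a nondecreasing,
Lipschitz continuous function of `t ≥ 0`, vanishing at `0`. -/
structure IsNetInflow (Y : Fluid → ℝ → ℝ) : Prop where
  zero : ∀ i, Y i 0 = 0
  mono : ∀ i, MonotoneOn (Y i) (Set.Ici 0)
  lipschitz : ∀ i, ∃ K, LipschitzOnWith K (Y i) (Set.Ici 0)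

/-- The state at time `t` of the non-homogeneous dynamical system `Δ(Y)` started from `x`. The
service rates are `γ_O = 3`, `γ_A = γ_B = 10`, `γ_AB = γ_BA = 2`. -/
def flow (Y : Fluid → ℝ → ℝ) (t : ℝ) (x : State) : State
  | .O => W 3 (x .O) (Y .O) t
  | .BA => W 2 (x .BA) (Y .BA) t
  | .AB => W 2 (x .AB) (Y .AB) t
  | .A => W 10 (5 * x .BA + x .A) (fun s => 5 * Y .BA s + Y .A s) t
      - 5 * W 2 (x .BA) (Y .BA) t
  | .B => W 10 (5 * x .AB + x .B) (fun s => 5 * Y .AB s + Y .B s) t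
      - 5 * W 2 (x .AB) (Y .AB) t

/-- The net outflow `Z(t) = x(0) + Y(t) - x(t)` of each fluid. -/
def netOutflow (Y : Fluid → ℝ → ℝ) (t : ℝ) (x : State) (i : Fluid) : ℝ :=
  x i + Y i t - flow Y t x i

/-! ### The non-linear dynamical system `Δ_∞` -/

/-- The set `𝒴(μ₀)` of the net inflows that are consistent with the initial measure `μ₀`: for all
times the inflows equal the `μ₀`-averages of the outflows which feed them. -/
def consistentInflows (μ₀ : Measure State) : Set (Fluid → ℝ → ℝ) :=
  {Y | IsNetInflow Y ∧ ∀ t, 0 ≤ t →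
    Y .O t = ∫ x, (netOutflow Y t x .AB + netOutflow Y t x .BA) ∂μ₀ ∧
    Y .A t = 1 / 2 * ∫ x, netOutflow Y t x .O ∂μ₀ ∧
    Y .B t = 1 / 2 * ∫ x, netOutflow Y t x .O ∂μ₀ ∧
    Y .AB t = ∫ x, netOutflow Y t x .A ∂μ₀ ∧
    Y .BA t = ∫ x, netOutflow Y t x .B ∂μ₀}

/-- The measure `μ(t)`: the initial measure `μ₀` transported by the dynamics `Δ(Y)`. For
`Y ∈ 𝒴(μ₀)` this is a trajectory of `Δ_∞`. -/
def evolve (Y : Fluid → ℝ → ℝ) (μ₀ : Measure State) (t : ℝ) : Measure State :=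
  μ₀.map (flow Y t)

/-! ### The cycle -/

/-- The first half of the cyclic trajectory of the closed network, `t ∈ [0, 1]`, started from
`x_A = 1`. For `t ≤ 1/9` it has `x_A = 1 - 9 t`, `x_B = t`, `x_AB = 8 t`; for `1/9 ≤ t ≤ 1` it has
`x_A = 0`, `x_B = t`, `x_AB = 1 - t`. -/
def halfCycle (t : ℝ) : State
  | .O => 0
  | .A => max (1 - 9 * t) 0
  | .B => t
  | .AB => min (8 * t) (1 - t)
  | .BA => 0

/-- The symmetry of the network that exchanges the two branches. -/
def swap (x : State) : State
  | .O => x .O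
  | .A => x .B
  | .B => x .A
  | .AB => x .BA
  | .BA => x .AB

/-- The cycle `𝒞`: the first half of the cyclic trajectory, and the second one, which is its mirror
image. -/
def cycle : Set State :=
  halfCycle '' Set.Icc 0 1 ∪ (fun t => swap (halfCycle t)) '' Set.Icc 0 1

/-! ### The functional `L` -/

/-- The maximal workload of the three nodes. -/
def maxWorkload (x : State) : ℝ :=
  max (max (1 / 2 * x .AB + 1 / 10 * x .B) (1 / 2 * x .BA + 1 / 10 * x .A)) (1 / 3 * x .O)

/-- The set `𝒦` of the states of the orthant all of whose workloads are less than `10`. -/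
def lowLoad : Set State := {x ∈ orthant | maxWorkload x < 10}

open Classical in
/-- The functional `L`, which vanishes on `𝒦` and is the maximal workload elsewhere. -/
def L (x : State) : ℝ := if x ∈ lowLoad then 0 else maxWorkload x

/-- The exponential moment `⟨exp (α L)⟩_μ`, with values in `[0, ∞]`. -/
def expMoment (α : ℝ) (μ : Measure State) : ℝ≥0∞ :=
  ∫⁻ x, ENNReal.ofReal (Real.exp (α * L x)) ∂μ

end FluidNetwork

end

open FluidNetwork

/-! Once the inflow is fixed, all states move under the same time-dependent flow, and the level of a
node is 1-Lipschitz in its initial value. The whole measure is therefore compared with one reference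
trajectory, that of a point of the cycle close to the initial measure. The mean distance to it stays
of the order of its initial value, so the reference trajectory solves the deterministic closed
network up to a small error `η` (`isAlmostClosed_flow`).

The closed network forgets errors. If nearly all the fluid is in `A`, then `AB` soon builds up and
blocks `B`. While `B` is blocked, `BA`, `O` and `A` drain in turn and the mass gathers in `B`. When
`AB` runs out, the state is charged again, with an error proportional to `η` whatever the previous
error was (`half_period`). Hence errors do not accumulate. Moreover `O` is fed at a long-run rate of
at most 5/2, below its capacity 3, and the balance equations make the other nodes underloaded as
well (`netput_le`).

An underloaded node forgets its initial level after a time linear in that level. With the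
exponential moment, the mean distance to the reference trajectory decays exponentially
(`rho_flow_le_exp`), and the same drift gives II (`L_flow_le`). So the closure error itself tends to
zero. Fed back into the deterministic analysis, the decayed error gives I (`nearCycle_of_improved`).
All the bounds depend on `α` and `A` only, which is the uniformity. -/

namespace FluidNetwork

/-! ### The reflection map of a single node. -/

section Reflection

variable {γ x₀ : ℝ} {Y : ℝ → ℝ} {s t u : ℝ}

theorem continuousOn_virtualLevel (hY : ContinuousOn Y (Set.Ici 0)) :
    ContinuousOn (virtualLevel γ x₀ Y) (Set.Icc 0 t) := by
  unfold virtualLevel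
  have : ContinuousOn Y (Set.Icc 0 t) := hY.mono Set.Icc_subset_Ici_self
  fun_prop

theorem le_W : x₀ + Y t - γ * t ≤ W γ x₀ Y t := by
  unfold W virtualLevel unusedCapacity
  linarith [le_max_left 0 (-sInf (virtualLevel γ x₀ Y '' Set.Icc 0 t))]

theorem le_W_of_mem (hY : ContinuousOn Y (Set.Ici 0)) (hu : u ∈ Set.Icc 0 t) :
    Y t - Y u - γ * (t - u) ≤ W γ x₀ Y t := by
  have hb : BddBelow (virtualLevel γ x₀ Y '' Set.Icc 0 t) :=
    isCompact_Icc.bddBelow_image (continuousOn_virtualLevel hY)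
  have h1 := csInf_le hb (Set.mem_image_of_mem _ hu)
  have h2 := le_max_right 0 (-sInf (virtualLevel γ x₀ Y '' Set.Icc 0 t))
  unfold W unusedCapacity
  have h3 : virtualLevel γ x₀ Y u = x₀ + Y u - γ * u := rfl
  have h4 : virtualLevel γ x₀ Y t = x₀ + Y t - γ * t := rfl
  linarith

/-- Together with `le_W` and `le_W_of_mem` this is a max-formula for `W`. The infimum is attained by
compactness, and only the first alternative remembers the initial level. -/
theorem W_eq_or (hY : ContinuousOn Y (Set.Ici 0)) (ht : 0 ≤ t) :
    W γ x₀ Y t = x₀ + Y t - γ * t ∨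
      ∃ u ∈ Set.Icc 0 t, W γ x₀ Y t = Y t - Y u - γ * (t - u) := by
  rcases max_choice 0 (-sInf (virtualLevel γ x₀ Y '' Set.Icc 0 t)) with h | h
  · left
    simp [W, unusedCapacity, h, virtualLevel]
  · right
    obtain ⟨u, hu, he⟩ := isCompact_Icc.exists_sInf_image_eq (Set.nonempty_Icc.2 ht)
      (continuousOn_virtualLevel (γ := γ) (x₀ := x₀) hY)
    refine ⟨u, hu, ?_⟩
    rw [W, unusedCapacity, h, he]
    simp only [virtualLevel]
    ring

theorem W_nonneg (hY : ContinuousOn Y (Set.Ici 0)) (ht : 0 ≤ t) : 0 ≤ W γ x₀ Y t := by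
  have := le_W_of_mem (γ := γ) (x₀ := x₀) hY (Set.right_mem_Icc.2 ht)
  simpa using this

theorem W_le_max (hY : ContinuousOn Y (Set.Ici 0)) (ht : 0 ≤ t) (y₀ : ℝ) :
    W γ x₀ Y t ≤ max (x₀ + Y t - γ * t) (W γ y₀ Y t) := by
  rcases W_eq_or (γ := γ) (x₀ := x₀) hY ht with h | ⟨u, hu, h⟩
  · exact h.le.trans (le_max_left _ _)
  · exact h.le.trans ((le_W_of_mem hY hu).trans (le_max_right _ _))

theorem abs_W_sub_le (hY : ContinuousOn Y (Set.Ici 0)) (ht : 0 ≤ t) (y₀ : ℝ) :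
    |W γ x₀ Y t - W γ y₀ Y t| ≤ |x₀ - y₀| := by
  have key : ∀ a b : ℝ, W γ a Y t - W γ b Y t ≤ |a - b| := by
    intro a b
    have h2 := le_W (γ := γ) (x₀ := b) (Y := Y) (t := t)
    rcases le_max_iff.1 (W_le_max (γ := γ) (x₀ := a) hY ht b) with h | h
    · linarith [le_abs_self (a - b)]
    · linarith [abs_nonneg (a - b)]
  rw [abs_le]
  constructor
  · have := key y₀ x₀
    rw [abs_sub_comm] at this
    linarith
  · exact key x₀ y₀

/-- Coalescence: two copies of a node differ only as long as one of them has never been idle. They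
agree once the netput has consumed both initial levels. -/
theorem abs_W_sub_le_max (hY : ContinuousOn Y (Set.Ici 0)) (ht : 0 ≤ t) {y₀ : ℝ}
    (hx : 0 ≤ x₀) (hy : 0 ≤ y₀) :
    |W γ x₀ Y t - W γ y₀ Y t| ≤ max (x₀ + y₀ + Y t - γ * t) 0 := by
  have key : ∀ a b : ℝ, 0 ≤ b →
      W γ a Y t - W γ b Y t ≤ max (a + b + Y t - γ * t) 0 := by
    intro a b hb
    have h0 := W_nonneg (γ := γ) (x₀ := b) hY ht
    rcases le_max_iff.1 (W_le_max (γ := γ) (x₀ := a) hY ht b) with h | h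
    · exact le_max_of_le_left (by linarith)
    · exact le_max_of_le_right (by linarith)
  rw [abs_le]
  constructor
  · have := key y₀ x₀ hx
    rw [add_comm y₀ x₀] at this
    linarith
  · exact key x₀ y₀ hy

/-- The level `w` of a work-conserving node of capacity `γ` with cumulative inflow `Y`, described
by properties of increments. -/
structure IsNode (γ : ℝ) (Y w : ℝ → ℝ) : Prop where
  nonneg : ∀ {t}, 0 ≤ t → 0 ≤ w t
  cont : ContinuousOn w (Set.Ici 0)
  service : ∀ {s t}, 0 ≤ s → s ≤ t → w s + (Y t - Y s) - γ * (t - s) ≤ w t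
  le_inflow : ∀ {s t}, 0 ≤ s → s ≤ t → w t ≤ w s + (Y t - Y s)
  busy_or : ∀ {s t}, 0 ≤ s → s ≤ t → w t = w s + (Y t - Y s) - γ * (t - s) ∨
    ∃ u, s ≤ u ∧ u ≤ t ∧ w u = 0 ∧ w t = Y t - Y u - γ * (t - u)

theorem isNode_W (hγ : 0 ≤ γ) (hY : ContinuousOn Y (Set.Ici 0)) (hm : MonotoneOn Y (Set.Ici 0)) :
    IsNode γ Y (W γ x₀ Y) := by
  have serv : ∀ {s t}, 0 ≤ s → s ≤ t →
      W γ x₀ Y s + (Y t - Y s) - γ * (t - s) ≤ W γ x₀ Y t := by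
    intro s t hs hst
    rcases W_eq_or (γ := γ) (x₀ := x₀) hY hs with h | ⟨u, hu, h⟩
    · linarith [le_W (γ := γ) (x₀ := x₀) (Y := Y) (t := t)]
    · linarith [le_W_of_mem (γ := γ) (x₀ := x₀) (t := t) hY ⟨hu.1, hu.2.trans hst⟩]
  have busy : ∀ {s t}, 0 ≤ s → s ≤ t →
      W γ x₀ Y t = W γ x₀ Y s + (Y t - Y s) - γ * (t - s) ∨
      ∃ u, s ≤ u ∧ u ≤ t ∧ W γ x₀ Y u = 0 ∧ W γ x₀ Y t = Y t - Y u - γ * (t - u) := by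
    intro s t hs hst
    have h3 := serv hs hst
    rcases W_eq_or (γ := γ) (x₀ := x₀) hY (hs.trans hst) with h | ⟨u, hu, h⟩
    · left
      linarith [le_W (γ := γ) (x₀ := x₀) (Y := Y) (t := s)]
    · rcases le_total u s with hus | hus
      · left
        linarith [le_W_of_mem (γ := γ) (x₀ := x₀) (t := s) hY ⟨hu.1, hus⟩]
      · right
        -- The node is empty at `u`: the service bound from `u` to `t` would otherwise exceed the
        -- value of `W` at `t`.
        refine ⟨u, hus, hu.2, ?_, h⟩
        have h4 := serv hu.1 hu.2
        have h5 := W_nonneg (γ := γ) (x₀ := x₀) hY hu.1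
        linarith
  have infl : ∀ {s t}, 0 ≤ s → s ≤ t → W γ x₀ Y t ≤ W γ x₀ Y s + (Y t - Y s) := by
    intro s t hs hst
    rcases busy hs hst with h | ⟨u, hu, hut, -, h⟩
    · nlinarith
    · have h1 := hm hs (hs.trans hu) hu
      have h2 := W_nonneg (γ := γ) (x₀ := x₀) hY hs
      nlinarith
  refine ⟨W_nonneg hY, ?_, serv, infl, busy⟩
  -- `W - Y` is minus the cumulative service, which grows at a rate between 0 and `γ`.
  have hL : LipschitzOnWith γ.toNNReal (fun t => W γ x₀ Y t - Y t) (Set.Ici 0) := by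
    have key : ∀ {a b : ℝ}, 0 ≤ a → a ≤ b →
        |(W γ x₀ Y a - Y a) - (W γ x₀ Y b - Y b)| ≤ γ * |a - b| := by
      intro a b ha hab
      have h1 := serv ha hab
      have h2 := infl ha hab
      rw [abs_le, abs_of_nonpos (by linarith : a - b ≤ 0)]
      constructor <;> nlinarith
    refine LipschitzOnWith.of_dist_le_mul fun a ha b hb => ?_
    rw [Real.dist_eq, Real.dist_eq, Real.coe_toNNReal _ hγ]
    rcases le_total a b with hab | hab
    · exact key ha hab
    · rw [abs_sub_comm, abs_sub_comm a b]
      exact key hb hab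
  exact (hL.continuousOn.add hY).congr fun t _ => by simp

theorem IsNode.busy {w : ℝ → ℝ} (h : IsNode γ Y w) (hs : 0 ≤ s) (hst : s ≤ t)
    (hpos : ∀ v, s ≤ v → v ≤ t → 0 < w v) : w t = w s + (Y t - Y s) - γ * (t - s) := by
  rcases h.busy_or hs hst with h1 | ⟨u, hu, hut, h0, -⟩
  · exact h1
  · exact absurd h0 (hpos u hu hut).ne'

theorem IsNode.shift {w : ℝ → ℝ} (h : IsNode γ Y w) {a : ℝ} (ha : 0 ≤ a) :
    IsNode γ (fun t => Y (a + t)) (fun t => w (a + t)) where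
  nonneg ht := h.nonneg (by linarith)
  cont := h.cont.comp (by fun_prop) (fun t ht => by
    have : (0 : ℝ) ≤ t := ht
    exact add_nonneg ha this)
  service hs hst := by
    have := h.service (s := a + _) (t := a + _) (add_nonneg ha hs) (add_le_add_right hst a)
    simpa using this
  le_inflow hs hst := h.le_inflow (add_nonneg ha hs) (add_le_add_right hst a)
  busy_or {s t} hs hst := by
    rcases h.busy_or (s := a + s) (t := a + t) (by linarith) (by linarith) with h1 | ⟨u, h1, h2, h3, h4⟩
    · left
      simpa using h1
    · right
      refine ⟨u - a, by linarith, by linarith, ?_, ?_⟩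
      · simpa using h3
      · simp only [add_sub_cancel]
        rw [h4]
        ring

end Reflection

/-! ### Almost closed paths and the blocking mechanism. -/

theorem sum_fluid {M : Type*} [AddCommMonoid M] (f : Fluid → M) :
    ∑ i, f i = f .O + f .A + f .B + f .AB + f .BA := by
  change ∑ i ∈ ({.O, .A, .B, .AB, .BA} : Finset Fluid), f i = _
  rw [Finset.sum_insert (by decide), Finset.sum_insert (by decide), Finset.sum_insert (by decide),
    Finset.sum_insert (by decide), Finset.sum_singleton]
  simp only [add_assoc]

/-- This makes the light level nonnegative. Since 5 * 2 = 10, five times the expression realizing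
the heavy level is, up to the nonnegative light inflow, one of the lower bounds for the joint
workload. -/
theorem five_mul_W (x : ℝ) (Y : ℝ → ℝ) (hY : ContinuousOn Y (Set.Ici 0)) {t : ℝ} (ht : 0 ≤ t)
    {a : ℝ} (ha : 0 ≤ a) {F : ℝ → ℝ} (hFc : ContinuousOn F (Set.Ici 0))
    (hF : MonotoneOn F (Set.Ici 0)) (hF0 : 0 ≤ F 0) :
    5 * W 2 x Y t ≤ W 10 (5 * x + a) (fun s => 5 * Y s + F s) t := by
  have hc : ContinuousOn (fun s => 5 * Y s + F s) (Set.Ici 0) := by fun_prop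
  rcases W_eq_or (γ := 2) (x₀ := x) hY ht with h | ⟨u, hu, h⟩
  · have h1 := le_W (γ := 10) (x₀ := 5 * x + a) (Y := fun s => 5 * Y s + F s) (t := t)
    have h2 : F 0 ≤ F t := hF Set.self_mem_Ici ht ht
    linarith
  · have h1 := le_W_of_mem (γ := 10) (x₀ := 5 * x + a) hc hu
    have h2 : F u ≤ F t := hF hu.1 ht hu.2
    linarith

/-- The outflow during `[s, t]` of fluid `i` along a path `c` with cumulative inflow `Y`. -/
def outflow (Y : Fluid → ℝ → ℝ) (c : ℝ → State) (i : Fluid) (s t : ℝ) : ℝ :=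
  c s i + (Y i t - Y i s) - c t i

/-- The path `c` is driven by the inflow `Y`, which agrees up to `η` with the one that the closed
network produces along `c`; the total mass of `c` is one up to `η`. -/
structure IsAlmostClosed (η : ℝ) (Y : Fluid → ℝ → ℝ) (c : ℝ → State) : Prop where
  nodeO : IsNode 3 (Y .O) (fun t => c t .O)
  nodeBA : IsNode 2 (Y .BA) (fun t => c t .BA)
  nodeAB : IsNode 2 (Y .AB) (fun t => c t .AB)
  nodeA : IsNode 10 (fun t => 5 * Y .BA t + Y .A t) (fun t => 5 * c t .BA + c t .A)
  nodeB : IsNode 10 (fun t => 5 * Y .AB t + Y .B t) (fun t => 5 * c t .AB + c t .B)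
  nonnegA : ∀ {t}, 0 ≤ t → 0 ≤ c t .A
  nonnegB : ∀ {t}, 0 ≤ t → 0 ≤ c t .B
  mono : ∀ i, MonotoneOn (Y i) (Set.Ici 0)
  closedO : ∀ {s t}, 0 ≤ s → s ≤ t →
    |Y .O t - Y .O s - (outflow Y c .AB s t + outflow Y c .BA s t)| ≤ η
  closedA : ∀ {s t}, 0 ≤ s → s ≤ t → |Y .A t - Y .A s - outflow Y c .O s t / 2| ≤ η
  closedB : ∀ {s t}, 0 ≤ s → s ≤ t → |Y .B t - Y .B s - outflow Y c .O s t / 2| ≤ η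
  closedAB : ∀ {s t}, 0 ≤ s → s ≤ t → |Y .AB t - Y .AB s - outflow Y c .A s t| ≤ η
  closedBA : ∀ {s t}, 0 ≤ s → s ≤ t → |Y .BA t - Y .BA s - outflow Y c .B s t| ≤ η
  mass : ∀ {t}, 0 ≤ t → |c t .O + c t .A + c t .B + c t .AB + c t .BA - 1| ≤ η

namespace IsAlmostClosed

variable {η δ e : ℝ} {Y : Fluid → ℝ → ℝ} {c : ℝ → State} {s t u : ℝ}

theorem shift (h : IsAlmostClosed η Y c) {a : ℝ} (ha : 0 ≤ a) :
    IsAlmostClosed η (fun i t => Y i (a + t)) (fun t => c (a + t)) where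
  nodeO := h.nodeO.shift ha
  nodeBA := h.nodeBA.shift ha
  nodeAB := h.nodeAB.shift ha
  nodeA := h.nodeA.shift ha
  nodeB := h.nodeB.shift ha
  nonnegA ht := h.nonnegA (add_nonneg ha ht)
  nonnegB ht := h.nonnegB (add_nonneg ha ht)
  mono i _ hs _ ht hst := h.mono i (add_nonneg ha hs) (add_nonneg ha ht) (add_le_add_right hst a)
  closedO hs hst := h.closedO (add_nonneg ha hs) (add_le_add_right hst a)
  closedA hs hst := h.closedA (add_nonneg ha hs) (add_le_add_right hst a)
  closedB hs hst := h.closedB (add_nonneg ha hs) (add_le_add_right hst a)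
  closedAB hs hst := h.closedAB (add_nonneg ha hs) (add_le_add_right hst a)
  closedBA hs hst := h.closedBA (add_nonneg ha hs) (add_le_add_right hst a)
  mass ht := h.mass (add_nonneg ha ht)

theorem mirror (h : IsAlmostClosed η Y c) :
    IsAlmostClosed η (fun i t => swap (fun j => Y j t) i) (fun t => swap (c t)) where
  nodeO := h.nodeO
  nodeBA := h.nodeAB
  nodeAB := h.nodeBA
  nodeA := h.nodeB
  nodeB := h.nodeA
  nonnegA ht := h.nonnegB ht
  nonnegB ht := h.nonnegA ht
  mono i := by cases i <;> exact h.mono _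
  closedO hs hst := by
    have := h.closedO hs hst
    rw [add_comm] at this
    exact this
  closedA hs hst := h.closedB hs hst
  closedB hs hst := h.closedA hs hst
  closedAB hs hst := h.closedBA hs hst
  closedBA hs hst := h.closedAB hs hst
  mass {t} ht := by
    have := h.mass ht
    simp only [swap]
    rwa [show c t .O + c t .B + c t .A + c t .BA + c t .AB - 1 =
      c t .O + c t .A + c t .B + c t .AB + c t .BA - 1 by ring]

/-- If `A` is large, then `AB` soon exceeds `BA`: the alternative that `AB` remains small would
force `BA` to be fed at a rate which the node `O` cannot sustain. -/
theorem exists_AB_gt (h : IsAlmostClosed η Y c) (hη : 0 < η) (hδ : 0 ≤ δ)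
    (hA : 1 - δ ≤ c 0 .A) (hs : 1000 * (δ + η) ≤ 1) :
    ∃ t, 0 ≤ t ∧ t ≤ 50 * (δ + η) ∧ c t .BA + 4 * η < c t .AB := by
  by_contra! hc
  -- While its node is busy, `A` sends out `10 T` minus five times the outflow of `BA`, whereas `BA`
  -- receives at most half of what `O` serves, `3 T / 2`. If `AB` stays below `BA + 4 η`, this gives
  -- `8 T ≤ 15 / 2 * T + 5 δ + 20 η`, false for this `T`.
  set T := 50 * (δ + η) with hT
  have hT0 : 0 ≤ T := by positivity
  have hpos : ∀ v, 0 ≤ v → v ≤ T → 0 < 5 * c v .BA + c v .A := by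
    intro v hv hvT
    have h1 := h.nodeA.service le_rfl hv
    have h2 := h.nodeBA.nonneg le_rfl
    have h3 := h.mono .BA Set.self_mem_Ici hv hv
    have h4 := h.mono .A Set.self_mem_Ici hv hv
    linarith
  have hbusy := h.nodeA.busy le_rfl hT0 hpos
  have hABT := hc T hT0 le_rfl
  have h1 := abs_le.1 (h.closedBA le_rfl hT0)
  have h2 := abs_le.1 (h.closedB le_rfl hT0)
  have h3 := abs_le.1 (h.closedAB le_rfl hT0)
  have h4 := h.nodeO.service le_rfl hT0
  have h5 := h.nodeAB.service le_rfl hT0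
  have h6 := abs_le.1 (h.mass le_rfl)
  have h7 := h.nonnegB hT0
  have h8 := h.nodeBA.nonneg hT0
  have h9 := h.nodeAB.nonneg le_rfl
  have h10 := h.nodeBA.nonneg le_rfl
  have h11 := h.nonnegB le_rfl
  have h12 := h.nodeO.nonneg le_rfl
  simp only [outflow] at *
  linarith

section Blocked

/-! Estimates on an interval `[u, t]` on which `AB` is present, so that `B` is blocked. -/

theorem outflow_AB_eq (h : IsAlmostClosed η Y c) (hu : 0 ≤ u) (hut : u ≤ t)
    (hpos : ∀ v, u ≤ v → v ≤ t → 0 < c v .AB) : outflow Y c .AB u t = 2 * (t - u) := by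
  have := h.nodeAB.busy hu hut hpos
  simp only [outflow]
  linarith

/-- Serving `AB` at rate 2 with weight 5 uses up the whole capacity 10 of the node. -/
theorem outflow_B_nonpos (h : IsAlmostClosed η Y c) (hu : 0 ≤ u) (hut : u ≤ t)
    (hpos : ∀ v, u ≤ v → v ≤ t → 0 < c v .AB) : outflow Y c .B u t ≤ 0 := by
  have h1 := h.outflow_AB_eq hu hut hpos
  have h2 := h.nodeB.service hu hut
  simp only [outflow] at *
  linarith

theorem inflow_BA_le (h : IsAlmostClosed η Y c) (hu : 0 ≤ u) (hut : u ≤ t)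
    (hpos : ∀ v, u ≤ v → v ≤ t → 0 < c v .AB) : Y .BA t - Y .BA u ≤ η := by
  have h1 := h.outflow_B_nonpos hu hut hpos
  have h2 := abs_le.1 (h.closedBA hu hut)
  linarith

theorem outflow_BA_le (h : IsAlmostClosed η Y c) (hu : 0 ≤ u) (hut : u ≤ t)
    (hpos : ∀ v, u ≤ v → v ≤ t → 0 < c v .AB) : outflow Y c .BA u t ≤ c u .BA + η := by
  have h1 := h.inflow_BA_le hu hut hpos
  have h2 := h.nodeBA.nonneg (hu.trans hut)
  simp only [outflow] at *
  linarith

theorem outflow_BA_nonneg (h : IsAlmostClosed η Y c) (hu : 0 ≤ u) (hut : u ≤ t) :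
    0 ≤ outflow Y c .BA u t := by
  have := h.nodeBA.le_inflow hu hut
  simp only [outflow] at *
  linarith

theorem BA_le (h : IsAlmostClosed η Y c) (hu : 0 ≤ u) (hut : u ≤ t)
    (hpos : ∀ v, u ≤ v → v ≤ t → 0 < c v .AB) : c t .BA ≤ c u .BA + η := by
  have h1 := h.inflow_BA_le hu hut hpos
  have h2 := h.nodeBA.le_inflow hu hut
  linarith

/-- Either `BA` is served at rate 2 throughout, or it was empty at some moment and has received at
most `η` since, because `B` is blocked. -/
theorem BA_le_or (h : IsAlmostClosed η Y c) (hu : 0 ≤ u) (hut : u ≤ t)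
    (hpos : ∀ v, u ≤ v → v ≤ t → 0 < c v .AB) :
    c t .BA ≤ c u .BA + η - 2 * (t - u) ∨ c t .BA ≤ η := by
  rcases h.nodeBA.busy_or hu hut with h1 | ⟨v, huv, hvt, -, h1⟩
  · left
    have := h.inflow_BA_le hu hut hpos
    linarith
  · right
    have := h.inflow_BA_le (hu.trans huv) hvt (fun w hw => hpos w (huv.trans hw))
    linarith

theorem inflow_O_le (h : IsAlmostClosed η Y c) (hu : 0 ≤ u) (hut : u ≤ t)
    (hpos : ∀ v, u ≤ v → v ≤ t → 0 < c v .AB) :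
    Y .O t - Y .O u ≤ 2 * (t - u) + c u .BA + 2 * η := by
  have h1 := h.outflow_AB_eq hu hut hpos
  have h2 := h.outflow_BA_le hu hut hpos
  have h3 := abs_le.1 (h.closedO hu hut)
  linarith

theorem le_inflow_O (h : IsAlmostClosed η Y c) (hu : 0 ≤ u) (hut : u ≤ t)
    (hpos : ∀ v, u ≤ v → v ≤ t → 0 < c v .AB) : 2 * (t - u) - η ≤ Y .O t - Y .O u := by
  have h1 := h.outflow_AB_eq hu hut hpos
  have h2 := h.outflow_BA_nonneg hu hut
  have h3 := abs_le.1 (h.closedO hu hut)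
  linarith

/-- `O` is fed by `AB` at rate 2 and served at rate 3, so it drains at rate 1. In the second
alternative `v` is a moment at which `O` is empty. -/
theorem O_le_or (h : IsAlmostClosed η Y c) (hu : 0 ≤ u) (hut : u ≤ t)
    (hpos : ∀ v, u ≤ v → v ≤ t → 0 < c v .AB) :
    c t .O ≤ c u .O + c u .BA + 2 * η - (t - u) ∨
      ∃ v, u ≤ v ∧ v ≤ t ∧ c t .O ≤ c v .BA + 2 * η - (t - v) := by
  rcases h.nodeO.busy_or hu hut with h1 | ⟨v, huv, hvt, -, h1⟩
  · left
    have := h.inflow_O_le hu hut hpos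
    linarith
  · right
    have := h.inflow_O_le (hu.trans huv) hvt (fun w hw => hpos w (huv.trans hw))
    exact ⟨v, huv, hvt, by linarith⟩

theorem O_le (h : IsAlmostClosed η Y c) (hη : 0 < η) (hu : 0 ≤ u) (hut : u ≤ t)
    (hpos : ∀ v, u ≤ v → v ≤ t → 0 < c v .AB) :
    c t .O ≤ c u .O + c u .BA + 3 * η := by
  rcases h.O_le_or hu hut hpos with h1 | ⟨v, huv, hvt, h1⟩
  · linarith
  · have h2 := h.BA_le hu huv (fun w hw hwv => hpos w hw (hwv.trans hvt))
    have h3 := h.nodeO.nonneg hu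
    linarith

theorem inflow_half_le (h : IsAlmostClosed η Y c) (hu : 0 ≤ u) (hut : u ≤ t)
    (hpos : ∀ v, u ≤ v → v ≤ t → 0 < c v .AB) :
    Y .A t - Y .A u ≤ (t - u) + c u .O / 2 + c u .BA / 2 + 2 * η ∧
    Y .B t - Y .B u ≤ (t - u) + c u .O / 2 + c u .BA / 2 + 2 * η := by
  have h1 := h.inflow_O_le hu hut hpos
  have h2 := abs_le.1 (h.closedA hu hut)
  have h3 := abs_le.1 (h.closedB hu hut)
  have h4 := h.nodeO.nonneg (hu.trans hut)
  simp only [outflow] at *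
  constructor <;> linarith

theorem le_inflow_half (h : IsAlmostClosed η Y c) (hη : 0 < η) (hu : 0 ≤ u) (hut : u ≤ t)
    (hpos : ∀ v, u ≤ v → v ≤ t → 0 < c v .AB) :
    (t - u) - c u .O / 2 - c u .BA / 2 - 3 * η ≤ Y .A t - Y .A u ∧
    (t - u) - c u .O / 2 - c u .BA / 2 - 3 * η ≤ Y .B t - Y .B u := by
  have h1 := h.le_inflow_O hu hut hpos
  have h2 := abs_le.1 (h.closedA hu hut)
  have h3 := abs_le.1 (h.closedB hu hut)
  have h4 := h.O_le hη hu hut hpos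
  have h5 := h.nodeO.nonneg hu
  simp only [outflow] at *
  constructor <;> linarith

/-- Fluid `A` arrives at rate about 1, half of the flow through `O`, against the capacity 10: this
is the slope 9 of the cycle. In the second alternative the node is empty at `v`. -/
theorem A_le_or (h : IsAlmostClosed η Y c) (hu : 0 ≤ u) (hut : u ≤ t)
    (hpos : ∀ v, u ≤ v → v ≤ t → 0 < c v .AB) :
    c t .A ≤ c u .A + 6 * c u .BA + c u .O + 7 * η - 9 * (t - u) ∨
      ∃ v, u ≤ v ∧ v ≤ t ∧ c t .A ≤ c v .O + c v .BA + 7 * η - 9 * (t - v) := by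
  have h0 := h.nodeBA.nonneg (hu.trans hut)
  have hO := h.nodeO.nonneg hu
  have hB := h.nodeBA.nonneg hu
  rcases h.nodeA.busy_or hu hut with h1 | ⟨v, huv, hvt, -, h1⟩
  · left
    have h2 := h.inflow_BA_le hu hut hpos
    have h3 := (h.inflow_half_le hu hut hpos).1
    linarith
  · right
    have h2 := h.inflow_BA_le (hu.trans huv) hvt (fun w hw => hpos w (huv.trans hw))
    have h3 := (h.inflow_half_le (hu.trans huv) hvt (fun w hw => hpos w (huv.trans hw))).1
    have hO' := h.nodeO.nonneg (hu.trans huv)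
    have hB' := h.nodeBA.nonneg (hu.trans huv)
    exact ⟨v, huv, hvt, by linarith⟩

/-- As long as `AB` is present, the path follows the first half of the cycle. -/
theorem track (h : IsAlmostClosed η Y c) (hη : 0 < η) (he : η ≤ e)
    (hA : |c 0 .A - max (1 - 9 * s) 0| ≤ e) (hB : |c 0 .B - s| ≤ e) (hO : c 0 .O ≤ e)
    (hBA : c 0 .BA ≤ e) (ht : 0 ≤ t) (hpos : ∀ v, 0 ≤ v → v ≤ t → 0 < c v .AB) :
    |c t .A - max (1 - 9 * (s + t)) 0| ≤ 20 * e ∧ |c t .B - (s + t)| ≤ 10 * e ∧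
      c t .O ≤ 10 * e ∧ c t .BA ≤ 2 * e ∧
      |c t .AB - (1 - (s + t) - max (1 - 9 * (s + t)) 0)| ≤ 43 * e := by
  have hO0 := h.nodeO.nonneg le_rfl
  have hBA0 := h.nodeBA.nonneg le_rfl
  have hOt := h.nodeO.nonneg ht
  have hBAt := h.nodeBA.nonneg ht
  have h1 := h.BA_le le_rfl ht hpos
  have h2 := h.O_le hη le_rfl ht hpos
  have h3 := h.inflow_half_le le_rfl ht hpos
  have h4 := h.le_inflow_half hη le_rfl ht hpos
  have h5 := h.outflow_B_nonpos le_rfl ht hpos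
  have h6 := abs_le.1 (h.closedBA le_rfl ht)
  have h7 := h.mono .BA Set.self_mem_Ici ht ht
  have h8 := abs_le.1 (h.mass ht)
  have h9 := h.nodeA.service le_rfl ht
  have hB' := abs_le.1 hB
  have hA' := abs_le.1 hA
  have hAt := h.nonnegA ht
  simp only [outflow] at *
  have KB : |c t .B - (s + t)| ≤ 10 * e := by
    rw [abs_le]; constructor <;> linarith
  have KA : |c t .A - max (1 - 9 * (s + t)) 0| ≤ 20 * e := by
    rw [abs_le]
    constructor
    · rcases max_choice (1 - 9 * (s + t)) 0 with hm | hm <;> rw [hm]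
      · have := le_max_left (1 - 9 * s) 0
        linarith
      · linarith
    · rcases h.A_le_or le_rfl ht hpos with h10 | ⟨v, hv, hvt, h10⟩
      · rcases max_choice (1 - 9 * s) 0 with hm | hm <;> rw [hm] at hA'
        · have := le_max_left (1 - 9 * (s + t)) 0
          linarith
        · have := le_max_right (1 - 9 * (s + t)) 0
          linarith
      · have hp : ∀ w, 0 ≤ w → w ≤ v → 0 < c w .AB := fun w hw hwv => hpos w hw (hwv.trans hvt)
        have h11 := h.BA_le le_rfl hv hp
        have h12 := h.O_le hη le_rfl hv hp
        have := le_max_right (1 - 9 * (s + t)) 0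
        linarith
  refine ⟨KA, KB, by linarith, by linarith, ?_⟩
  -- `AB` is read off from the total mass, the errors adding up to 20 + 10 + 10 + 2 + 1 = 43.
  have KA' := abs_le.1 KA
  have KB' := abs_le.1 KB
  rw [abs_le]
  constructor <;> linarith

end Blocked

end IsAlmostClosed

/-! ### Distance to the cycle, and the half-period map. -/

theorem rho_eq (x y : State) : rho x y =
    |x .O - y .O| + |x .A - y .A| + |x .B - y .B| + |x .AB - y .AB| + |x .BA - y .BA| := by
  rw [rho, sum_fluid]

theorem rho_swap (x y : State) : rho (swap x) (swap y) = rho x y := by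
  simp only [rho_eq, swap]
  ring

theorem swap_swap (x : State) : swap (swap x) = x := by
  funext i
  cases i <;> rfl

theorem swap_mem_cycle {z : State} (hz : z ∈ cycle) : swap z ∈ cycle := by
  rcases hz with ⟨t, ht, rfl⟩ | ⟨t, ht, rfl⟩
  · exact Or.inr ⟨t, ht, rfl⟩
  · exact Or.inl ⟨t, ht, (swap_swap _).symm⟩

/-- The state `x` is within distance `d` of the cycle. -/
def NearCycle (d : ℝ) (x : State) : Prop := ∃ z ∈ cycle, rho x z ≤ d

theorem NearCycle.of_swap {d : ℝ} {x : State} (h : NearCycle d (swap x)) : NearCycle d x := by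
  obtain ⟨z, hz, hd⟩ := h
  refine ⟨swap z, swap_mem_cycle hz, ?_⟩
  rwa [← rho_swap, swap_swap]

/-- Almost all the mass is in one of the two light fluids. -/
def IsCharged (δ : ℝ) (x : State) : Prop := 1 - δ ≤ x .A ∨ 1 - δ ≤ x .B

theorem IsCharged.of_swap {δ : ℝ} {x : State} (h : IsCharged δ (swap x)) : IsCharged δ x :=
  Or.symm h

/-- Converts the output of `track` into a distance. The phase `u` may overshoot 1 because the time
when `AB` runs out is known only up to `45 * e`; past 1 the comparison is with the end point of the
half cycle. -/
theorem nearCycle_of_abs_le {e u : ℝ} {x : State} (he : 0 ≤ e) (hu : 0 ≤ u) (hu' : u ≤ 1 + 45 * e)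
    (hO : 0 ≤ x .O) (hBA : 0 ≤ x .BA)
    (h : |x .A - max (1 - 9 * u) 0| ≤ 20 * e ∧ |x .B - u| ≤ 10 * e ∧
      x .O ≤ 10 * e ∧ x .BA ≤ 2 * e ∧ |x .AB - (1 - u - max (1 - 9 * u) 0)| ≤ 43 * e) :
    NearCycle (200 * e) x := by
  obtain ⟨h1, h2, h3, h4, h5⟩ := h
  rcases le_total u 1 with hu1 | hu1
  · refine ⟨halfCycle u, Or.inl ⟨u, ⟨hu, hu1⟩, rfl⟩, ?_⟩
    rw [rho_eq]
    simp only [halfCycle, sub_zero]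
    have : 1 - u - max (1 - 9 * u) 0 = min (8 * u) (1 - u) := by
      rcases le_total (1 - 9 * u) 0 with h0 | h0
      · rw [max_eq_right h0, min_eq_right (by linarith)]; ring
      · rw [max_eq_left h0, min_eq_left (by linarith)]; ring
    rw [this] at h5
    rw [abs_of_nonneg hO, abs_of_nonneg hBA]
    linarith
  · refine ⟨halfCycle 1, Or.inl ⟨1, by norm_num, rfl⟩, ?_⟩
    rw [rho_eq]
    simp only [halfCycle, sub_zero]
    rw [max_eq_right (by linarith)] at h1 h5
    rw [max_eq_right (by norm_num), min_eq_right (by norm_num), abs_of_nonneg hO,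
      abs_of_nonneg hBA]
    have h6 : |x .B - 1| ≤ 55 * e := by
      rw [abs_le] at h2 ⊢; constructor <;> linarith
    have h7 : |x .AB - (1 - 1)| ≤ 88 * e := by
      rw [abs_le] at h5 ⊢; constructor <;> linarith
    linarith

namespace IsAlmostClosed

variable {η δ e : ℝ} {Y : Fluid → ℝ → ℝ} {c : ℝ → State} {s t u : ℝ}

/-- The threshold is `η` rather than 0, so that `AB` is still positive at the final time and the
estimates for blocked `B` hold up to and including it. -/
theorem exists_first_AB_eq (h : IsAlmostClosed η Y c) {b : ℝ} (hb : 0 ≤ b) (hη : 0 < η)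
    (h0 : η < c 0 .AB) (h1 : c b .AB ≤ η) :
    ∃ t, 0 ≤ t ∧ t ≤ b ∧ c t .AB = η ∧ ∀ v, 0 ≤ v → v ≤ t → 0 < c v .AB := by
  have hcont : ContinuousOn (fun t => c t .AB) (Set.Icc 0 b) :=
    h.nodeAB.cont.mono Set.Icc_subset_Ici_self
  have hcl : IsClosed (Set.Icc 0 b ∩ (fun t => c t .AB) ⁻¹' {η}) :=
    hcont.preimage_isClosed_of_isClosed isClosed_Icc isClosed_singleton
  have hne : (Set.Icc 0 b ∩ (fun t => c t .AB) ⁻¹' {η}).Nonempty := by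
    obtain ⟨t, ht, he⟩ := intermediate_value_Icc' hb hcont ⟨h1, h0.le⟩
    exact ⟨t, ht, he⟩
  obtain ⟨t, ⟨ht, hte⟩, hleast⟩ :=
    (isCompact_Icc.of_isClosed_subset hcl Set.inter_subset_left).exists_isLeast hne
  refine ⟨t, ht.1, ht.2, hte, fun v hv hvt => ?_⟩
  by_contra! hle
  have hvt' : v < t := lt_of_le_of_ne hvt fun heq => by
    rw [heq] at hle
    have : c t .AB = η := hte
    linarith
  obtain ⟨w, hw, hwe⟩ := intermediate_value_Icc' hv
    (hcont.mono (Set.Icc_subset_Icc_right (hvt.trans ht.2))) ⟨hle.trans hη.le, h0.le⟩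
  have := hleast ⟨⟨hw.1, hw.2.trans (hvt.trans ht.2)⟩, hwe⟩
  linarith [hw.2]

/-- Starting near the point `halfCycle s`, the fluid `AB` is present until time `1 - s`. -/
theorem exists_emptying (h : IsAlmostClosed η Y c) (hη : 0 < η) (he : η ≤ e) (he' : e ≤ 1 / 1000)
    (hs : 0 ≤ s) (hA : |c 0 .A - max (1 - 9 * s) 0| ≤ e) (hB : |c 0 .B - s| ≤ e)
    (hO : c 0 .O ≤ e) (hBA : c 0 .BA ≤ e) (hAB : c 0 .BA + 4 * η < c 0 .AB) :
    ∃ t, 0 ≤ t ∧ t ≤ 2 ∧ |s + t - 1| ≤ 45 * e ∧ c t .AB = η ∧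
      ∀ v, 0 ≤ v → v ≤ t → 0 < c v .AB := by
  have hBA0 := h.nodeBA.nonneg le_rfl
  have hex : ∃ b, 0 ≤ b ∧ b ≤ 2 ∧ c b .AB ≤ η := by
    by_contra! hc
    have := h.track hη he hA hB hO hBA zero_le_two (fun v hv hv2 => hη.trans (hc v hv hv2))
    have h1 := (abs_le.1 this.2.2.2.2).2
    have h2 := hc 2 zero_le_two le_rfl
    have h3 := le_max_right (1 - 9 * (s + 2)) 0
    linarith
  obtain ⟨b, hb, hb2, hbη⟩ := hex
  obtain ⟨t, ht, htb, hte, hpos⟩ := h.exists_first_AB_eq hb hη (by linarith) hbη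
  refine ⟨t, ht, htb.trans hb2, ?_, hte, hpos⟩
  have h1 := abs_le.1 (h.track hη he hA hB hO hBA ht hpos).2.2.2.2
  rw [hte] at h1
  rcases max_choice (1 - 9 * (s + t)) 0 with hm | hm <;> rw [hm] at h1
  -- In this branch `s + t` is of order `e`, so the node of `A` is still busy and `AB` gains at
  -- least `8 t - η` minus five times the outflow of `BA`. That outflow is at most `2 t` and at most
  -- `c 0 .BA + η`; using the first bound four times and the second once leaves `AB` above `2 η`, by
  -- `hAB`.
  · exfalso
    have hA' := abs_le.1 hA
    have hsm := le_max_left (1 - 9 * s) 0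
    have hApos : ∀ v, 0 ≤ v → v ≤ t → 0 < 5 * c v .BA + c v .A := by
      intro v hv hvT
      have h1 := h.nodeA.service le_rfl hv
      have h3 := h.mono .BA Set.self_mem_Ici hv hv
      have h4 := h.mono .A Set.self_mem_Ici hv hv
      linarith
    have h2 := h.nodeA.busy le_rfl ht hApos
    have h3 := h.outflow_BA_le le_rfl ht hpos
    have h4 := h.nodeBA.service le_rfl ht
    have h5 := h.nodeAB.service le_rfl ht
    have h6 := abs_le.1 (h.closedAB le_rfl ht)
    simp only [outflow] at *
    linarith
  · have := le_max_left (1 - 9 * (s + t)) 0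
    rw [abs_le]
    constructor <;> linarith

/-- At the end of a half period the memory of the initial state is lost. -/
theorem le_B_of_late (h : IsAlmostClosed η Y c) (hη : 0 < η) (he : η ≤ e) (he' : e ≤ 1 / 1000)
    (hO : c 0 .O ≤ e) (hBA : c 0 .BA ≤ e) (hA : c 0 .A ≤ 1 + e) (ht : 3 / 4 ≤ t)
    (hpos : ∀ v, 0 ≤ v → v ≤ t → 0 < c v .AB) (hAB : c t .AB = η) : 1 - 100 * η ≤ c t .B := by
  have ht0 : 0 ≤ t := by linarith
  have hp : ∀ w, w ≤ t → ∀ v, 0 ≤ v → v ≤ w → 0 < c v .AB :=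
    fun w hw v hv hvw => hpos v hv (hvw.trans hw)
  -- The fluids clear one after the other: `BA` by time 1/4, then `O`, which it feeds, by 1/2, and
  -- then `A` by 3/4. After that only errors of order `η` remain.
  have KBA : ∀ v, 1 / 4 ≤ v → v ≤ t → c v .BA ≤ η := by
    intro v hv hvt
    rcases h.BA_le_or le_rfl (by linarith) (hp v hvt) with h1 | h1
    · have := h.nodeBA.nonneg (by linarith : 0 ≤ v)
      linarith
    · exact h1
  have KO : ∀ v, 1 / 2 ≤ v → v ≤ t → c v .O ≤ 3 * η := by
    intro v hv hvt
    have h0 := h.nodeO.nonneg (by linarith : 0 ≤ v)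
    rcases h.O_le_or le_rfl (by linarith) (hp v hvt) with h1 | ⟨w, hw, hwv, h1⟩
    · linarith
    · rcases le_total (1 / 4) w with h4 | h4
      · linarith [KBA w h4 (hwv.trans hvt)]
      · linarith [h.BA_le le_rfl hw (hp w (hwv.trans hvt))]
  have KA : c t .A ≤ 11 * η := by
    have h0 := h.nonnegA ht0
    rcases h.A_le_or le_rfl ht0 hpos with h1 | ⟨w, hw, hwv, h1⟩
    · linarith
    · rcases le_total (1 / 2) w with h4 | h4
      · linarith [KBA w (by linarith) hwv, KO w h4 hwv]
      · linarith [h.BA_le le_rfl hw (hp w hwv), h.O_le hη le_rfl hw (hp w hwv)]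
  have h1 := abs_le.1 (h.mass ht0)
  linarith [KBA t (by linarith) le_rfl, KO t (by linarith) le_rfl]

theorem half_period_of_A (h : IsAlmostClosed η Y c) (hη : 0 < η) (hηδ : η ≤ δ)
    (hδ : δ ≤ 1 / 10 ^ 7) (hA : 1 - δ ≤ c 0 .A) :
    ∃ t, 3 / 4 ≤ t ∧ t ≤ 2 ∧ 1 - 100 * η ≤ c t .B ∧
      (∀ v, 0 ≤ v → v ≤ t → NearCycle (10 ^ 6 * δ) (c v)) ∧
      Y .O t - Y .O 0 ≤ 5 / 2 * t := by
  have hδ0 : 0 < δ := hη.trans_le hηδ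
  obtain ⟨a, ha, haT, haAB⟩ := h.exists_AB_gt hη hδ0.le hA (by norm_num at hδ; linarith)
  -- Until `a ≤ 100 δ` the behaviour of the heavy fluids is not controlled, but `A` loses at most
  -- `10 a ≤ 1000 δ`. From `a` on, the comparison with the half cycle starts at phase 0 with error
  -- `1002 δ`.
  have early : ∀ v, 0 ≤ v → v ≤ a → 1 - 1001 * δ ≤ c v .A ∧ c v .A ≤ 1 + δ ∧
      0 ≤ c v .O ∧ 0 ≤ c v .B ∧ 0 ≤ c v .AB ∧ 0 ≤ c v .BA ∧
      c v .O + c v .B + c v .AB + c v .BA ≤ 1002 * δ := by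
    intro v hv hva
    have h1 := h.nodeA.service le_rfl hv
    have h2 := h.nodeBA.le_inflow le_rfl hv
    have h3 := h.mono .BA Set.self_mem_Ici hv hv
    have h4 := h.mono .A Set.self_mem_Ici hv hv
    have h5 := abs_le.1 (h.mass hv)
    have h6 := h.nodeO.nonneg hv
    have h7 := h.nodeAB.nonneg hv
    have h8 := h.nodeBA.nonneg hv
    have h9 := h.nonnegB hv
    have h10 : 1 - 1001 * δ ≤ c v .A := by linarith
    refine ⟨h10, by linarith, h6, h9, h7, h8, by linarith⟩
  obtain ⟨a1, a2, a3, a4, a5, a6, a7⟩ := early a ha le_rfl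
  have g := h.shift ha
  have gA : |c (a + 0) .A - max (1 - 9 * 0) 0| ≤ 1002 * δ := by
    rw [add_zero, mul_zero, sub_zero, max_eq_left zero_le_one, abs_le]
    constructor <;> linarith
  have gB : |c (a + 0) .B - 0| ≤ 1002 * δ := by
    rw [add_zero, sub_zero, abs_of_nonneg a4]; linarith
  have gO : c (a + 0) .O ≤ 1002 * δ := by rw [add_zero]; linarith
  have gBA : c (a + 0) .BA ≤ 1002 * δ := by rw [add_zero]; linarith
  have gAB : c (a + 0) .BA + 4 * η < c (a + 0) .AB := by rwa [add_zero]
  have he : η ≤ 1002 * δ := by linarith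
  have he' : 1002 * δ ≤ 1 / 1000 := by norm_num at hδ; linarith
  obtain ⟨t, ht, ht2, ht1, hte, hpos⟩ := g.exists_emptying hη he he' le_rfl gA gB gO gBA gAB
  have ht1' := abs_le.1 ht1
  norm_num at hδ
  refine ⟨a + t, by linarith, by linarith, ?_, ?_, ?_⟩
  · exact g.le_B_of_late hη he he' gO gBA (by rw [add_zero]; linarith) (by linarith) hpos hte
  · intro v hv hvt
    rcases le_total v a with hva | hva
    · obtain ⟨b1, b2, b3, b4, b5, b6, b7⟩ := early v hv hva
      refine ⟨halfCycle 0, Or.inl ⟨0, by norm_num, rfl⟩, ?_⟩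
      rw [rho_eq]
      simp only [halfCycle, mul_zero, sub_zero]
      rw [max_eq_left zero_le_one, min_eq_left zero_le_one, sub_zero, abs_of_nonneg b3,
        abs_of_nonneg b4, abs_of_nonneg b5, abs_of_nonneg b6]
      have : |c v .A - 1| ≤ 1001 * δ := by
        rw [abs_le]; constructor <;> linarith
      linarith
    · obtain ⟨w, rfl⟩ : ∃ w, v = a + w := ⟨v - a, by ring⟩
      have hw : 0 ≤ w := by linarith
      have hwt : w ≤ t := by linarith
      have h1 := g.track hη he gA gB gO gBA hw (fun x hx hxw => hpos x hx (hxw.trans hwt))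
      rw [zero_add] at h1 ht1'
      obtain ⟨z, hz, hd⟩ := nearCycle_of_abs_le (by linarith) hw (by linarith)
        (g.nodeO.nonneg hw) (g.nodeBA.nonneg hw) h1
      exact ⟨z, hz, hd.trans (by linarith)⟩
  -- Up to time `a` the inflow is at most `4 a + η`, and afterwards it has rate 2 up to small
  -- errors. Since the half period lasts at least 3/4, the margin between 2 and 5/2 absorbs the
  -- rest.
  · have h1 := g.inflow_O_le le_rfl ht hpos
    have h2 := abs_le.1 (h.closedO le_rfl ha)
    have h3 := h.nodeAB.service le_rfl ha
    have h4 := h.nodeBA.service le_rfl ha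
    simp only [outflow] at *
    rw [add_zero] at h1
    linarith

/-- From a charged state, the system reaches another charged state after about a half period, and
stays near the cycle in between. -/
theorem half_period (h : IsAlmostClosed η Y c) (hη : 0 < η) (hηδ : η ≤ δ)
    (hδ : δ ≤ 1 / 10 ^ 7) (hA : IsCharged δ (c 0)) :
    ∃ t, 3 / 4 ≤ t ∧ t ≤ 2 ∧ IsCharged (100 * η) (c t) ∧
      (∀ v, 0 ≤ v → v ≤ t → NearCycle (10 ^ 6 * δ) (c v)) ∧
      Y .O t - Y .O 0 ≤ 5 / 2 * t := by
  rcases hA with hA | hA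
  · obtain ⟨t, h1, h2, h3, h4, h5⟩ := h.half_period_of_A hη hηδ hδ hA
    exact ⟨t, h1, h2, Or.inr h3, h4, h5⟩
  · obtain ⟨t, h1, h2, h3, h4, h5⟩ := h.mirror.half_period_of_A hη hηδ hδ hA
    exact ⟨t, h1, h2, Or.inl h3, fun v hv hvt => (h4 v hv hvt).of_swap, h5⟩

theorem exists_isCharged_of_halfCycle (h : IsAlmostClosed η Y c) (hη : 0 < η) (hη' : η ≤ 1 / 1000)
    (hs : 0 ≤ s) (h0 : c 0 = halfCycle s) :
    ∃ t, 0 ≤ t ∧ t ≤ 2 ∧ IsCharged (100 * η) (c t) := by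
  -- Close to either end of the half cycle the state is already charged. In between, `min (8 * s) (1
  -- - s)` exceeds `4 η`, as `exists_emptying` requires.
  by_cases h1 : s ≤ η
  · refine ⟨0, le_rfl, zero_le_two, Or.inl ?_⟩
    rw [h0]
    have := le_max_left (1 - 9 * s) 0
    simp only [halfCycle]
    linarith
  by_cases h2 : 1 - 5 * η ≤ s
  · refine ⟨0, le_rfl, zero_le_two, Or.inr ?_⟩
    rw [h0]
    simp only [halfCycle]
    linarith
  push Not at h1 h2
  have hA : |c 0 .A - max (1 - 9 * s) 0| ≤ η := by rw [h0]; simp [halfCycle, hη.le]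
  have hB : |c 0 .B - s| ≤ η := by rw [h0]; simp [halfCycle, hη.le]
  have hO : c 0 .O ≤ η := by rw [h0]; simp [halfCycle, hη.le]
  have hBA : c 0 .BA ≤ η := by rw [h0]; simp [halfCycle, hη.le]
  have hAB : c 0 .BA + 4 * η < c 0 .AB := by
    rw [h0]
    simp only [halfCycle]
    exact lt_min (by linarith) (by linarith)
  obtain ⟨t, ht, ht2, ht1, hte, hpos⟩ := h.exists_emptying hη le_rfl hη' hs hA hB hO hBA hAB
  refine ⟨t, ht, ht2, Or.inr ?_⟩
  have h3 := abs_le.1 (h.track hη le_rfl hA hB hO hBA ht hpos).2.1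
  have h4 := abs_le.1 ht1
  linarith

theorem exists_isCharged (h : IsAlmostClosed η Y c) (hη : 0 < η) (hη' : η ≤ 1 / 1000)
    (h0 : c 0 ∈ cycle) : ∃ t, 0 ≤ t ∧ t ≤ 2 ∧ IsCharged (100 * η) (c t) := by
  rcases h0 with ⟨s, hs, h0⟩ | ⟨s, hs, h0⟩
  · exact h.exists_isCharged_of_halfCycle hη hη' hs.1 h0.symm
  · obtain ⟨t, h1, h2, h3⟩ := h.mirror.exists_isCharged_of_halfCycle hη hη' hs.1
      (by rw [← h0]; exact swap_swap _)
    exact ⟨t, h1, h2, h3.of_swap⟩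

/-- A path that starts on the cycle returns to charged states again and again. -/
theorem exists_isCharged_ge (h : IsAlmostClosed η Y c) (hη : 0 < η) (hη' : η ≤ 1 / 10 ^ 9)
    (h0 : c 0 ∈ cycle) (ht : 0 ≤ t) :
    ∃ u, t ≤ u ∧ u ≤ t + 3 ∧ IsCharged (100 * η) (c u) ∧ Y .O u - Y .O 0 ≤ 5 / 2 * u + 10 := by
  norm_num at hη'
  -- Induction in time steps of 1/2, shorter than any half period. The constant 10 in the inflow
  -- bound pays for the time, at most 2, before the first charged state.
  have key : ∀ n : ℕ, ∀ t : ℝ, 0 ≤ t → t ≤ n / 2 →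
      ∃ u, t ≤ u ∧ u ≤ t + 3 ∧ IsCharged (100 * η) (c u) ∧ Y .O u - Y .O 0 ≤ 5 / 2 * u + 10 := by
    intro n
    induction n with
    | zero =>
      intro t ht ht'
      have ht0 : t = 0 := le_antisymm (by simpa using ht') ht
      subst ht0
      obtain ⟨u, hu, hu2, hc⟩ := h.exists_isCharged hη (by linarith) h0
      refine ⟨u, hu, by linarith, hc, ?_⟩
      have h2 := abs_le.1 (h.closedO le_rfl hu)
      have h3 := h.nodeAB.service le_rfl hu
      have h4 := h.nodeBA.service le_rfl hu
      simp only [outflow] at *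
      linarith
    | succ n ih =>
      intro t ht ht'
      push_cast at ht'
      have hb1 := le_max_left 0 (t - 1 / 2)
      have hb2 := le_max_right 0 (t - 1 / 2)
      have hb3 : max 0 (t - 1 / 2) ≤ t := max_le ht (by linarith)
      obtain ⟨u, hu, hu3, hc, hY⟩ := ih (max 0 (t - 1 / 2)) hb1
        (max_le (by positivity) (by linarith))
      rcases le_total t u with htu | htu
      · exact ⟨u, htu, by linarith, hc, hY⟩
      · obtain ⟨w, hw, hw2, hc', -, hY'⟩ := (h.shift (a := u) (by linarith)).half_period hη
          (δ := 100 * η) (by linarith) (by norm_num; linarith) (by simpa using hc)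
        refine ⟨u + w, by linarith, by linarith, hc', ?_⟩
        simp only [add_zero] at hY'
        linarith
  obtain ⟨n, hn⟩ := exists_nat_ge (2 * t)
  exact key n t ht (by linarith)

theorem inflow_O_le_of_cycle (h : IsAlmostClosed η Y c) (hη : 0 < η) (hη' : η ≤ 1 / 10 ^ 9)
    (h0 : c 0 ∈ cycle) (ht : 0 ≤ t) : Y .O t - Y .O 0 ≤ 5 / 2 * t + 20 := by
  obtain ⟨u, hu, hu3, -, hY⟩ := h.exists_isCharged_ge hη hη' h0 ht
  have := h.mono .O ht (ht.trans hu) hu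
  linarith

/-- Each half period ends in a state charged with the same error `100 * η`, so half periods can be
chained without loss. -/
theorem nearCycle_of_isCharged (h : IsAlmostClosed η Y c) (hη : 0 < η) (hη' : η ≤ 1 / 10 ^ 9)
    (h0 : IsCharged (100 * η) (c 0)) (ht : 0 ≤ t) : NearCycle (10 ^ 8 * η) (c t) := by
  norm_num at hη'
  have key : ∀ n : ℕ, ∀ a, 0 ≤ a → IsCharged (100 * η) (c a) → ∀ v : ℝ, 0 ≤ v → v ≤ n / 2 →
      NearCycle (10 ^ 8 * η) (c (a + v)) := by
    intro n
    induction n with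
    | zero =>
      intro a ha hc v hv hv'
      obtain ⟨w, hw, -, -, hn, -⟩ := (h.shift ha).half_period hη (δ := 100 * η)
        (by linarith) (by norm_num; linarith) (by simpa using hc)
      obtain ⟨z, hz, hd⟩ := hn v hv (by norm_num at hv'; linarith)
      exact ⟨z, hz, hd.trans (by linarith)⟩
    | succ n ih =>
      intro a ha hc v hv hv'
      push_cast at hv'
      obtain ⟨w, hw, -, hc', hn, -⟩ := (h.shift ha).half_period hη (δ := 100 * η)
        (by linarith) (by norm_num; linarith) (by simpa using hc)
      rcases le_total v w with hvw | hvw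
      · obtain ⟨z, hz, hd⟩ := hn v hv hvw
        exact ⟨z, hz, hd.trans (by linarith)⟩
      · have := ih (a + w) (by linarith) hc' (v - w) (by linarith) (by linarith)
        rwa [show a + w + (v - w) = a + v by ring] at this
  obtain ⟨n, hn⟩ := exists_nat_ge (2 * t)
  have := key n 0 le_rfl h0 t ht (by linarith)
  rwa [zero_add] at this

/-- If the closure error decreases from `η` to `η'` at time `a`, then the distance to the cycle
becomes of order `η'` soon after `a`. -/
theorem nearCycle_of_improved {η' a : ℝ} (h : IsAlmostClosed η Y c) (hη : 0 < η)
    (hη' : η ≤ 1 / 10 ^ 9) (h0 : c 0 ∈ cycle) (ha : 0 ≤ a)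
    (g : IsAlmostClosed η' (fun i t => Y i (a + t)) (fun t => c (a + t))) (gη : 0 < η')
    (gη' : η' ≤ η) (ht : a + 5 ≤ t) : NearCycle (10 ^ 8 * η') (c t) := by
  obtain ⟨u, hu, hu3, hc, -⟩ := h.exists_isCharged_ge hη hη' h0 ha
  have g1 := g.shift (a := u - a) (by linarith)
  -- One half period under the smaller error turns `100 * η` into `100 * η'`. The charged state
  -- comes by `a + 3` and the half period takes at most 2, whence `a + 5`.
  obtain ⟨w, hw, hw2, hc', -, -⟩ := g1.half_period gη (δ := 100 * η) (by linarith)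
    (by norm_num at hη' ⊢; linarith) (by simpa using hc)
  have g2 := g1.shift (a := w) (by linarith)
  have := g2.nearCycle_of_isCharged (t := t - u - w) gη (by linarith)
    (by simpa using hc') (by linarith)
  rwa [show a + (u - a + (w + (t - u - w))) = t by ring] at this

end IsAlmostClosed

/-! ### Regularity and positivity of the flow. -/

section Flow

variable {Y : Fluid → ℝ → ℝ} {t : ℝ} {x y z : State}

theorem IsNetInflow.continuousOn (hY : IsNetInflow Y) (i : Fluid) :
    ContinuousOn (Y i) (Set.Ici 0) := by
  obtain ⟨K, hK⟩ := hY.lipschitz i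
  exact hK.continuousOn

theorem IsNetInflow.continuousOn_comb (hY : IsNetInflow Y) (i j : Fluid) :
    ContinuousOn (fun s => 5 * Y i s + Y j s) (Set.Ici 0) :=
  (continuousOn_const.mul (hY.continuousOn i)).add (hY.continuousOn j)

theorem IsNetInflow.monotoneOn_comb (hY : IsNetInflow Y) (i j : Fluid) :
    MonotoneOn (fun s => 5 * Y i s + Y j s) (Set.Ici 0) := fun s hs u hu hsu => by
  have h1 := hY.mono i hs hu hsu
  have h2 := hY.mono j hs hu hsu
  simp only
  linarith

theorem abs_flow_sub_le (x y : State) :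
    |flow Y t x .A - flow Y t y .A| ≤
      |W 10 (5 * x .BA + x .A) (fun s => 5 * Y .BA s + Y .A s) t -
        W 10 (5 * y .BA + y .A) (fun s => 5 * Y .BA s + Y .A s) t| +
      5 * |W 2 (x .BA) (Y .BA) t - W 2 (y .BA) (Y .BA) t| ∧
    |flow Y t x .B - flow Y t y .B| ≤
      |W 10 (5 * x .AB + x .B) (fun s => 5 * Y .AB s + Y .B s) t -
        W 10 (5 * y .AB + y .B) (fun s => 5 * Y .AB s + Y .B s) t| +
      5 * |W 2 (x .AB) (Y .AB) t - W 2 (y .AB) (Y .AB) t| := by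
  have key : ∀ a b c d : ℝ, |a - 5 * b - (c - 5 * d)| ≤ |a - c| + 5 * |b - d| := by
    intro a b c d
    calc |a - 5 * b - (c - 5 * d)| = |(a - c) - 5 * (b - d)| := by congr 1; ring
      _ ≤ |a - c| + |5 * (b - d)| := abs_sub _ _
      _ = _ := by rw [abs_mul, abs_of_pos (by norm_num : (0 : ℝ) < 5)]
  exact ⟨key _ _ _ _, key _ _ _ _⟩

/-- Every reflection is 1-Lipschitz in its initial level. A heavy level counts once for itself and
twice with weight 5 in the light one, so 16 is generous. -/
theorem rho_flow_le (hY : IsNetInflow Y) (ht : 0 ≤ t) (x y : State) :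
    rho (flow Y t x) (flow Y t y) ≤ 16 * rho x y := by
  have h1 := abs_W_sub_le (γ := 3) (x₀ := x .O) (hY.continuousOn .O) ht (y .O)
  have h2 := abs_W_sub_le (γ := 2) (x₀ := x .BA) (hY.continuousOn .BA) ht (y .BA)
  have h3 := abs_W_sub_le (γ := 2) (x₀ := x .AB) (hY.continuousOn .AB) ht (y .AB)
  have h4 := abs_W_sub_le (γ := 10) (x₀ := 5 * x .BA + x .A) (hY.continuousOn_comb .BA .A) ht
    (5 * y .BA + y .A)
  have h5 := abs_W_sub_le (γ := 10) (x₀ := 5 * x .AB + x .B) (hY.continuousOn_comb .AB .B) ht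
    (5 * y .AB + y .B)
  obtain ⟨h6, h7⟩ := abs_flow_sub_le (Y := Y) (t := t) x y
  have key : ∀ a b c d : ℝ, |5 * a + b - (5 * c + d)| ≤ 5 * |a - c| + |b - d| := by
    intro a b c d
    calc |5 * a + b - (5 * c + d)| = |5 * (a - c) + (b - d)| := by congr 1; ring
      _ ≤ |5 * (a - c)| + |b - d| := abs_add_le _ _
      _ = _ := by rw [abs_mul, abs_of_pos (by norm_num : (0 : ℝ) < 5)]
  have h8 := key (x .BA) (x .A) (y .BA) (y .A)
  have h9 := key (x .AB) (x .B) (y .AB) (y .B)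
  have e1 : |flow Y t x .O - flow Y t y .O| ≤ |x .O - y .O| := h1
  have e2 : |flow Y t x .BA - flow Y t y .BA| ≤ |x .BA - y .BA| := h2
  have e3 : |flow Y t x .AB - flow Y t y .AB| ≤ |x .AB - y .AB| := h3
  rw [rho_eq, rho_eq]
  linarith [abs_nonneg (x .O - y .O), abs_nonneg (x .A - y .A), abs_nonneg (x .B - y .B),
    abs_nonneg (x .AB - y .AB), abs_nonneg (x .BA - y .BA)]

theorem continuous_W {γ t : ℝ} {F : ℝ → ℝ} (hF : ContinuousOn F (Set.Ici 0)) (ht : 0 ≤ t) :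
    Continuous fun a => W γ a F t :=
  (LipschitzWith.of_dist_le_mul (K := 1) fun a b => by
    simpa [Real.dist_eq] using abs_W_sub_le hF ht b).continuous

theorem continuous_flow (hY : IsNetInflow Y) (ht : 0 ≤ t) : Continuous (flow Y t) := by
  have h1 := continuous_W (γ := 3) (hY.continuousOn .O) ht
  have h2 := continuous_W (γ := 2) (hY.continuousOn .BA) ht
  have h3 := continuous_W (γ := 2) (hY.continuousOn .AB) ht
  have h4 := continuous_W (γ := 10) (hY.continuousOn_comb .BA .A) ht
  have h5 := continuous_W (γ := 10) (hY.continuousOn_comb .AB .B) ht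
  refine continuous_pi fun i => ?_
  cases i
  · exact h1.comp (continuous_apply _)
  · exact (h4.comp (by fun_prop : Continuous fun x : State => 5 * x .BA + x .A)).sub
      (continuous_const.mul (h2.comp (continuous_apply _)))
  · exact (h5.comp (by fun_prop : Continuous fun x : State => 5 * x .AB + x .B)).sub
      (continuous_const.mul (h3.comp (continuous_apply _)))
  · exact h3.comp (continuous_apply _)
  · exact h2.comp (continuous_apply _)

theorem flow_mem_orthant (hY : IsNetInflow Y) (ht : 0 ≤ t) (hx : x ∈ orthant) :
    flow Y t x ∈ orthant := by
  intro i
  cases i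
  · exact W_nonneg (hY.continuousOn _) ht
  · exact sub_nonneg.2 (five_mul_W _ _ (hY.continuousOn _) ht (hx .A) (hY.continuousOn _)
      (hY.mono _) (hY.zero _).ge)
  · exact sub_nonneg.2 (five_mul_W _ _ (hY.continuousOn _) ht (hx .B) (hY.continuousOn _)
      (hY.mono _) (hY.zero _).ge)
  · exact W_nonneg (hY.continuousOn _) ht
  · exact W_nonneg (hY.continuousOn _) ht

theorem flow_zero (hY : IsNetInflow Y) (hx : x ∈ orthant) : flow Y 0 x = x := by
  have key : ∀ {γ a : ℝ} {F : ℝ → ℝ}, F 0 = 0 → 0 ≤ a → W γ a F 0 = a := by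
    intro γ a F hF ha
    simp [W, virtualLevel, unusedCapacity, hF, ha]
  have h0 := hY.zero
  funext i
  cases i <;> simp only [flow]
  · exact key (h0 _) (hx _)
  · rw [key (by simp [h0]) (by linarith [hx .BA, hx .A]), key (h0 _) (hx _)]; ring
  · rw [key (by simp [h0]) (by linarith [hx .AB, hx .B]), key (h0 _) (hx _)]; ring
  · exact key (h0 _) (hx _)
  · exact key (h0 _) (hx _)

theorem mem_orthant_of_mem_cycle (hz : z ∈ cycle) : z ∈ orthant ∧ ∀ i, z i ≤ 1 := by
  have key : ∀ s ∈ Set.Icc (0 : ℝ) 1, ∀ i, 0 ≤ halfCycle s i ∧ halfCycle s i ≤ 1 := by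
    intro s hs i
    cases i <;> simp only [halfCycle]
    · norm_num
    · exact ⟨le_max_right _ _, max_le (by linarith [hs.1]) zero_le_one⟩
    · exact hs
    · exact ⟨le_min (by linarith [hs.1]) (by linarith [hs.2]),
        (min_le_right _ _).trans (by linarith [hs.1])⟩
    · norm_num
  rcases hz with ⟨s, hs, rfl⟩ | ⟨s, hs, rfl⟩
  · exact ⟨fun i => (key s hs i).1, fun i => (key s hs i).2⟩
  · refine ⟨fun i => ?_, fun i => ?_⟩
    · cases i
      exacts [(key s hs .O).1, (key s hs .B).1, (key s hs .A).1, (key s hs .BA).1, (key s hs .AB).1]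
    · cases i
      exacts [(key s hs .O).2, (key s hs .B).2, (key s hs .A).2, (key s hs .BA).2, (key s hs .AB).2]

end Flow

/-! ### Transport distance to a point mass. -/

section Krov

/-- Under a coupling with a point mass the second coordinate is almost surely constant, so the cost
depends on the first marginal only. -/
theorem lintegral_rho_lt_of_krov_lt {μ : Measure State} {z : State} {r : ℝ≥0∞}
    (h : krov μ (Measure.dirac z) < r) : ∫⁻ x, ENNReal.ofReal (rho x z) ∂μ < r := by
  unfold krov at h
  simp only [iInf_lt_iff] at h
  obtain ⟨κ, ⟨h1, h2⟩, h3⟩ := h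
  have hae : ∀ᵐ p ∂κ, p.2 = z := by
    refine ae_of_ae_map (f := Prod.snd) measurable_snd.aemeasurable (p := fun y => y = z) ?_
    rw [h2]
    exact (ae_dirac_iff (measurableSet_singleton z)).2 rfl
  have hm : Measurable fun x : State => ENNReal.ofReal (rho x z) := by
    unfold rho
    fun_prop
  rw [← h1, lintegral_map hm measurable_fst]
  refine lt_of_le_of_lt (lintegral_mono_ae ?_) h3
  filter_upwards [hae] with p hp
  rw [hp]

theorem krov_dirac_le (μ : Measure State) [IsProbabilityMeasure μ] (z : State) :
    krov μ (Measure.dirac z) ≤ ∫⁻ x, ENNReal.ofReal (rho x z) ∂μ := by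
  have hf : Measurable fun x : State => (x, z) := by fun_prop
  have hm : Measurable fun p : State × State => ENNReal.ofReal (rho p.1 p.2) := by
    unfold rho
    fun_prop
  refine iInf₂_le_of_le (μ.map fun x => (x, z)) ⟨?_, ?_⟩ ?_
  · rw [Measure.map_map measurable_fst hf]
    exact Measure.map_id
  · rw [Measure.map_map measurable_snd hf]
    change Measure.map (fun _ => z) μ = _
    rw [Measure.map_const, measure_univ, one_smul]
  · rw [lintegral_map hm hf]

end Krov

theorem rho_nonneg (x y : State) : 0 ≤ rho x y := Finset.sum_nonneg fun _ _ => abs_nonneg _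

theorem abs_sub_le_rho (x y : State) (i : Fluid) : |x i - y i| ≤ rho x y :=
  Finset.single_le_sum (f := fun i => |x i - y i|) (fun _ _ => abs_nonneg _) (Finset.mem_univ i)

theorem rho_triangle (x y z : State) : rho x z ≤ rho x y + rho y z := by
  unfold rho
  rw [← Finset.sum_add_distrib]
  exact Finset.sum_le_sum fun i _ => abs_sub_le _ _ _

theorem continuous_rho_right (z : State) : Continuous fun x => rho x z := by
  unfold rho
  fun_prop

/-! ### From the measure to a single almost closed path. -/

section Mean

variable {μ : Measure State} [IsProbabilityMeasure μ] {Y : Fluid → ℝ → ℝ} {t : ℝ} {z : State}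

theorem integrable_rho (hμ : ∀ i, Integrable (fun x : State => x i) μ) (z : State) :
    Integrable (fun x => rho x z) μ := by
  unfold rho
  exact integrable_finsetSum _ fun i _ => ((hμ i).sub (integrable_const _)).abs

theorem integrable_rho_flow (hμ : ∀ i, Integrable (fun x : State => x i) μ) (hY : IsNetInflow Y)
    (ht : 0 ≤ t) (z : State) : Integrable (fun x => rho (flow Y t x) (flow Y t z)) μ := by
  refine ((integrable_rho hμ z).const_mul 16).mono' ?_ (ae_of_all _ fun x => ?_)
  · exact ((continuous_rho_right _).comp (continuous_flow hY ht)).aestronglyMeasurable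
  · rw [Real.norm_eq_abs, abs_of_nonneg (rho_nonneg _ _)]
    exact rho_flow_le hY ht x z

theorem integrable_flow (hμ : ∀ i, Integrable (fun x : State => x i) μ) (hY : IsNetInflow Y)
    (ht : 0 ≤ t) (i : Fluid) : Integrable (fun x => flow Y t x i) μ := by
  refine ((integrable_rho_flow hμ hY ht 0).add (integrable_const |flow Y t 0 i|)).mono' ?_
    (ae_of_all _ fun x => ?_)
  · exact ((continuous_apply i).comp (continuous_flow hY ht)).aestronglyMeasurable
  · have h1 := abs_sub_le_rho (flow Y t x) (flow Y t 0) i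
    have h2 := abs_sub_abs_le_abs_sub (flow Y t x i) (flow Y t 0 i)
    rw [Real.norm_eq_abs]
    simp only [Pi.add_apply]
    linarith

theorem integral_netOutflow (hμ : ∀ i, Integrable (fun x : State => x i) μ) (hY : IsNetInflow Y)
    (ht : 0 ≤ t) (i : Fluid) :
    Integrable (fun x => netOutflow Y t x i) μ ∧
    ∫ x, netOutflow Y t x i ∂μ = ∫ x, x i ∂μ + Y i t - ∫ x, flow Y t x i ∂μ := by
  have h1 := integrable_flow hμ hY ht i
  have h2 : Integrable (fun x : State => x i + Y i t) μ := (hμ i).add (integrable_const (Y i t))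
  refine ⟨h2.sub h1, ?_⟩
  unfold netOutflow
  rw [integral_sub h2 h1, integral_add (hμ i) (integrable_const _)]
  simp

theorem sum_abs_integral_flow_sub_le (hμ : ∀ i, Integrable (fun x : State => x i) μ)
    (hY : IsNetInflow Y) (ht : 0 ≤ t) (z : State) :
    ∑ i, |∫ x, flow Y t x i ∂μ - flow Y t z i| ≤ ∫ x, rho (flow Y t x) (flow Y t z) ∂μ := by
  have hi : ∀ i, Integrable (fun x => flow Y t x i - flow Y t z i) μ :=
    fun i => (integrable_flow hμ hY ht i).sub (integrable_const _)
  unfold rho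
  rw [integral_finsetSum _ fun i _ => (hi i).abs]
  refine Finset.sum_le_sum fun i _ => ?_
  have : ∫ x, flow Y t x i ∂μ - flow Y t z i = ∫ x, (flow Y t x i - flow Y t z i) ∂μ := by
    rw [integral_sub (integrable_flow hμ hY ht i) (integrable_const _)]
    simp
  rw [this]
  exact abs_integral_le_integral_abs

/-- The trajectory of a single state `z`, driven by a consistent inflow, almost solves the closed
network equations if the measure stays concentrated near it. -/
theorem isAlmostClosed_flow (hμ : ∀ i, Integrable (fun x : State => x i) μ)
    (hmass : ∫ x, (x .A + x .B + x .BA + x .AB + x .O) ∂μ = 1)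
    (hY : Y ∈ consistentInflows μ) (hz : z ∈ orthant) {a η : ℝ} (ha : 0 ≤ a)
    (hD : ∀ t, a ≤ t → 2 * ∫ x, rho (flow Y t x) (flow Y t z) ∂μ ≤ η) :
    IsAlmostClosed η (fun i t => Y i (a + t)) (fun t => flow Y (a + t) z) := by
  obtain ⟨hYn, hcons⟩ := hY
  have hM : ∫ x, x .A ∂μ + ∫ x, x .B ∂μ + ∫ x, x .BA ∂μ + ∫ x, x .AB ∂μ + ∫ x, x .O ∂μ = 1 := by
    rw [← hmass, integral_add, integral_add, integral_add, integral_add]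
    all_goals first | exact hμ _ | skip
    · exact (hμ _).add (hμ _)
    · exact ((hμ _).add (hμ _)).add (hμ _)
    · exact (((hμ _).add (hμ _)).add (hμ _)).add (hμ _)
  have hmean : ∀ t, 0 ≤ t →
      Y .O t = (∫ x, x .AB ∂μ + Y .AB t - ∫ x, flow Y t x .AB ∂μ) +
        (∫ x, x .BA ∂μ + Y .BA t - ∫ x, flow Y t x .BA ∂μ) ∧
      Y .A t = 1 / 2 * (∫ x, x .O ∂μ + Y .O t - ∫ x, flow Y t x .O ∂μ) ∧
      Y .B t = 1 / 2 * (∫ x, x .O ∂μ + Y .O t - ∫ x, flow Y t x .O ∂μ) ∧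
      Y .AB t = ∫ x, x .A ∂μ + Y .A t - ∫ x, flow Y t x .A ∂μ ∧
      Y .BA t = ∫ x, x .B ∂μ + Y .B t - ∫ x, flow Y t x .B ∂μ := by
    intro t ht
    have hn := fun i => integral_netOutflow hμ hYn ht i
    obtain ⟨h1, h2, h3, h4, h5⟩ := hcons t ht
    rw [integral_add (hn _).1 (hn _).1] at h1
    simp only [(hn _).2] at h1 h2 h3 h4 h5
    exact ⟨h1, h2, h3, h4, h5⟩
  -- Closure is required of increments over `[s, t]`, and each end point contributes a deviation of
  -- at most `η / 2`: hence the factor 2 in `hD`. Deviations before time `a` do not enter.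
  have hdev : ∀ t, a ≤ t → ∃ p : Fluid → ℝ, 2 * (p .O + p .A + p .B + p .AB + p .BA) ≤ η ∧
      ∀ i, -p i ≤ ∫ x, flow Y t x i ∂μ - flow Y t z i ∧
        ∫ x, flow Y t x i ∂μ - flow Y t z i ≤ p i := by
    intro t ht
    have h1 := sum_abs_integral_flow_sub_le hμ hYn (ha.trans ht) z
    rw [sum_fluid] at h1
    exact ⟨_, by linarith [hD t ht], fun i => abs_le.1 le_rfl⟩
  have node := fun {γ x₀ : ℝ} (hγ : 0 ≤ γ) (i : Fluid) =>
    (isNode_W (x₀ := x₀) hγ (hYn.continuousOn i) (hYn.mono i)).shift ha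
  have pair := fun {x₀ : ℝ} (i j : Fluid) => (isNode_W (γ := 10) (x₀ := x₀) (by norm_num)
    (hYn.continuousOn_comb i j) (hYn.monotoneOn_comb i j)).shift ha
  refine ⟨node (by norm_num) .O, node (by norm_num) .BA, node (by norm_num) .AB, ?_, ?_,
    fun ht => flow_mem_orthant hYn (add_nonneg ha ht) hz .A,
    fun ht => flow_mem_orthant hYn (add_nonneg ha ht) hz .B,
    fun i s hs t ht hst => hYn.mono i (add_nonneg ha hs) (add_nonneg ha ht)
      (add_le_add_right hst a), ?_, ?_, ?_, ?_, ?_, ?_⟩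
  · simpa [flow] using pair (x₀ := 5 * z .BA + z .A) .BA .A
  · simpa [flow] using pair (x₀ := 5 * z .AB + z .B) .AB .B
  -- Adding the five mean balance equations cancels all the inflows, so the mean total mass stays 1.
  case refine_8 =>
    intro s hs
    obtain ⟨e1, e2, e3, e4, e5⟩ := hmean (a + s) (by linarith)
    obtain ⟨p, hp, d⟩ := hdev (a + s) (by linarith)
    obtain ⟨d1, d1'⟩ := d .O
    obtain ⟨d2, d2'⟩ := d .A
    obtain ⟨d3, d3'⟩ := d .B
    obtain ⟨d4, d4'⟩ := d .AB
    obtain ⟨d5, d5'⟩ := d .BA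
    rw [abs_le]
    constructor <;> linarith
  all_goals
    intro s t hs hst
    obtain ⟨e1, e2, e3, e4, e5⟩ := hmean (a + s) (by linarith)
    obtain ⟨f1, f2, f3, f4, f5⟩ := hmean (a + t) (by linarith)
    obtain ⟨p, hp, d⟩ := hdev (a + s) (by linarith)
    obtain ⟨d1, d1'⟩ := d .O
    obtain ⟨d2, d2'⟩ := d .A
    obtain ⟨d3, d3'⟩ := d .B
    obtain ⟨d4, d4'⟩ := d .AB
    obtain ⟨d5, d5'⟩ := d .BA
    obtain ⟨q, hq, g⟩ := hdev (a + t) (by linarith)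
    obtain ⟨g1, g1'⟩ := g .O
    obtain ⟨g2, g2'⟩ := g .A
    obtain ⟨g3, g3'⟩ := g .B
    obtain ⟨g4, g4'⟩ := g .AB
    obtain ⟨g5, g5'⟩ := g .BA
    simp only [outflow]
    rw [abs_le]
    constructor <;> linarith

end Mean

/-! ### Underload, coalescence and exponential moments. -/

section Tail

variable {Y : Fluid → ℝ → ℝ} {t η α : ℝ} {x z : State}

/-- The netput of every node started from zero is at most `80 - t / 2`. -/
def NetputLe (Y : Fluid → ℝ → ℝ) (t : ℝ) : Prop :=
  Y .O t - 3 * t ≤ 80 - t / 2 ∧ Y .BA t - 2 * t ≤ 80 - t / 2 ∧ Y .AB t - 2 * t ≤ 80 - t / 2 ∧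
    5 * Y .BA t + Y .A t - 10 * t ≤ 80 - t / 2 ∧ 5 * Y .AB t + Y .B t - 10 * t ≤ 80 - t / 2

/-- The inflow into every node falls short of its capacity, linearly in time. -/
theorem IsAlmostClosed.netput_le {c : ℝ → State} (h : IsAlmostClosed η Y c) (hη : 0 < η)
    (hη' : η ≤ 1 / 10 ^ 9) (h0 : c 0 ∈ cycle) (hY : ∀ i, Y i 0 = 0) (ht : 0 ≤ t) : NetputLe Y t := by
  have h1 := h.inflow_O_le_of_cycle hη hη' h0 ht
  norm_num at hη'
  have hc := (mem_orthant_of_mem_cycle h0).2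
  have c1 := hc .O
  have c2 := hc .A
  have c3 := hc .B
  have h2 := abs_le.1 (h.closedA le_rfl ht)
  have h3 := abs_le.1 (h.closedB le_rfl ht)
  have h4 := abs_le.1 (h.closedAB le_rfl ht)
  have h5 := abs_le.1 (h.closedBA le_rfl ht)
  have h6 := h.nodeO.nonneg ht
  have h7 := h.nonnegA ht
  have h8 := h.nonnegB ht
  simp only [outflow, hY] at *
  unfold NetputLe
  -- The inflow of `O` has rate 5/2, and every other fluid receives about half of it, 5/4. The nodes
  -- of capacity 10 then carry 5 * 5/4 + 5/4 = 15/2, so `O` is the tight case.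
  refine ⟨?_, ?_, ?_, ?_, ?_⟩ <;> linarith

theorem workload_le (x : State) : x .AB / 2 + x .B / 10 ≤ maxWorkload x ∧
    x .BA / 2 + x .A / 10 ≤ maxWorkload x ∧ x .O / 3 ≤ maxWorkload x := by
  unfold maxWorkload
  refine ⟨?_, ?_, ?_⟩
  · refine le_trans (le_of_eq (by ring)) ((le_max_left _ _).trans (le_max_left _ _))
  · refine le_trans (le_of_eq (by ring)) ((le_max_right _ _).trans (le_max_left _ _))
  · exact le_trans (le_of_eq (by ring)) (le_max_right _ _)

theorem maxWorkload_le_L (x : State) : maxWorkload x ≤ L x + 10 := by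
  unfold L
  split_ifs with h
  · linarith [h.2]
  · linarith

/-- Coalescence in all the nodes at once. The factor 15 counts three single levels and two light
ones with weight 1 + 5 each; 90 is the constant 80 of the netput plus room for the levels of `z`. -/
theorem rho_flow_le_of_netputLe (hY : IsNetInflow Y) (ht : 0 ≤ t) (hN : NetputLe Y t)
    (hx : x ∈ orthant) (hz : z ∈ cycle) :
    rho (flow Y t x) (flow Y t z) ≤ 15 * max (10 * maxWorkload x + 90 - t / 2) 0 := by
  obtain ⟨n1, n2, n3, n4, n5⟩ := hN
  obtain ⟨w1, w2, w3⟩ := workload_le x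
  obtain ⟨hz0, hz1⟩ := mem_orthant_of_mem_cycle hz
  have x1 := hx .O
  have x2 := hx .A
  have x3 := hx .B
  have x4 := hx .AB
  have x5 := hx .BA
  have y1 := hz0 .O
  have y2 := hz0 .A
  have y3 := hz0 .B
  have y4 := hz0 .AB
  have y5 := hz0 .BA
  have z1 := hz1 .O
  have z2 := hz1 .A
  have z3 := hz1 .B
  have z4 := hz1 .AB
  have z5 := hz1 .BA
  have h1 := abs_W_sub_le_max (γ := 3) (hY.continuousOn .O) ht x1 y1
  have h2 := abs_W_sub_le_max (γ := 2) (hY.continuousOn .BA) ht x5 y5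
  have h3 := abs_W_sub_le_max (γ := 2) (hY.continuousOn .AB) ht x4 y4
  have h4 := abs_W_sub_le_max (γ := 10) (x₀ := 5 * x .BA + x .A) (y₀ := 5 * z .BA + z .A)
    (hY.continuousOn_comb .BA .A) ht (by linarith) (by linarith)
  have h5 := abs_W_sub_le_max (γ := 10) (x₀ := 5 * x .AB + x .B) (y₀ := 5 * z .AB + z .B)
    (hY.continuousOn_comb .AB .B) ht (by linarith) (by linarith)
  obtain ⟨h6, h7⟩ := abs_flow_sub_le (Y := Y) (t := t) x z
  have e1 : |flow Y t x .O - flow Y t z .O| ≤ _ := h1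
  have e2 : |flow Y t x .BA - flow Y t z .BA| ≤ _ := h2
  have e3 : |flow Y t x .AB - flow Y t z .AB| ≤ _ := h3
  have key : ∀ {a : ℝ}, a ≤ 10 * maxWorkload x + 90 - t / 2 →
      max a 0 ≤ max (10 * maxWorkload x + 90 - t / 2) 0 := fun h => max_le_max_right 0 h
  have k1 := h1.trans (key (by linarith))
  have k2 := h2.trans (key (by linarith))
  have k3 := h3.trans (key (by linarith))
  have k4 := h4.trans (key (by linarith))
  have k5 := h5.trans (key (by linarith))
  have f1 := e1.trans (key (by linarith))
  have f2 := e2.trans (key (by linarith))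
  have f3 := e3.trans (key (by linarith))
  rw [rho_eq]
  linarith

/-- Replaces the positive part of a linear function by an exponential, so that the exponential
moment controls its mean. The 19 is (90 + 100) / 10, from `maxWorkload x ≤ L x + 10`. -/
theorem rho_flow_le_exp (hα : 0 < α) (hY : IsNetInflow Y) (ht : 0 ≤ t) (hN : NetputLe Y t)
    (hx : x ∈ orthant) (hz : z ∈ cycle) :
    rho (flow Y t x) (flow Y t z) ≤
      150 / α * Real.exp (α * (19 - t / 20)) * Real.exp (α * L x) := by
  refine (rho_flow_le_of_netputLe hY ht hN hx hz).trans ?_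
  have h1 := maxWorkload_le_L x
  rw [mul_assoc, ← Real.exp_add]
  have h2 : max (10 * maxWorkload x + 90 - t / 2) 0 ≤
      10 / α * Real.exp (α * (19 - t / 20) + α * L x) := by
    refine max_le ?_ (by positivity)
    have h3 := Real.add_one_le_exp (α * (19 - t / 20) + α * L x)
    calc 10 * maxWorkload x + 90 - t / 2 ≤ 10 / α * (α * (19 - t / 20) + α * L x) := by
          field_simp
          linarith
      _ ≤ _ := by gcongr; linarith
  calc 15 * max (10 * maxWorkload x + 90 - t / 2) 0
      ≤ 15 * (10 / α * Real.exp (α * (19 - t / 20) + α * L x)) := by gcongr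
    _ = _ := by ring

/-- The node with the largest workload either still depends on its initial level, and then its
workload has changed by the negative drift, or it is dominated by the reference trajectory, whose
workloads are far below 10. The latter is excluded off `lowLoad`. -/
theorem L_flow_le (hY : IsNetInflow Y) (ht : 0 ≤ t) (hN : NetputLe Y t)
    (hx : x ∈ orthant) (hz : ∀ i, 0 ≤ flow Y t z i ∧ flow Y t z i ≤ 3 / 2)
    (hL : flow Y t x ∉ lowLoad) : L (flow Y t x) ≤ L x + 40 - t / 20 := by
  obtain ⟨n1, n2, n3, n4, n5⟩ := hN
  obtain ⟨w1, w2, w3⟩ := workload_le x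
  have h1 := maxWorkload_le_L x
  have h10 : 10 ≤ maxWorkload (flow Y t x) := by
    by_contra! hlt
    exact hL ⟨flow_mem_orthant hY ht hx, hlt⟩
  rw [L, if_neg hL]
  have z1 := hz .O
  have z2 := hz .A
  have z3 := hz .B
  have z4 := hz .AB
  have z5 := hz .BA
  have k1 := W_le_max (γ := 3) (x₀ := x .O) (hY.continuousOn .O) ht (z .O)
  have k2 := W_le_max (γ := 10) (x₀ := 5 * x .BA + x .A) (hY.continuousOn_comb .BA .A) ht
    (5 * z .BA + z .A)
  have k3 := W_le_max (γ := 10) (x₀ := 5 * x .AB + x .B) (hY.continuousOn_comb .AB .B) ht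
    (5 * z .AB + z .B)
  simp only [flow] at z1 z2 z3 z4 z5
  generalize hm : maxWorkload (flow Y t x) = m at *
  simp only [maxWorkload, flow] at hm
  rcases max_choice (max (1 / 2 * W 2 (x .AB) (Y .AB) t +
      1 / 10 * (W 10 (5 * x .AB + x .B) (fun s => 5 * Y .AB s + Y .B s) t
        - 5 * W 2 (x .AB) (Y .AB) t))
      (1 / 2 * W 2 (x .BA) (Y .BA) t +
      1 / 10 * (W 10 (5 * x .BA + x .A) (fun s => 5 * Y .BA s + Y .A s) t
        - 5 * W 2 (x .BA) (Y .BA) t))) (1 / 3 * W 3 (x .O) (Y .O) t) with h2 | h2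
  · rw [h2] at hm
    rcases max_choice (1 / 2 * W 2 (x .AB) (Y .AB) t +
      1 / 10 * (W 10 (5 * x .AB + x .B) (fun s => 5 * Y .AB s + Y .B s) t
        - 5 * W 2 (x .AB) (Y .AB) t))
      (1 / 2 * W 2 (x .BA) (Y .BA) t +
      1 / 10 * (W 10 (5 * x .BA + x .A) (fun s => 5 * Y .BA s + Y .A s) t
        - 5 * W 2 (x .BA) (Y .BA) t)) with h3 | h3
    · rw [h3] at hm
      rcases le_max_iff.1 k3 with h4 | h4 <;> linarith
    · rw [h3] at hm
      rcases le_max_iff.1 k2 with h4 | h4 <;> linarith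
  · rw [h2] at hm
    rcases le_max_iff.1 k1 with h4 | h4 <;> linarith

theorem continuous_maxWorkload : Continuous maxWorkload := by
  unfold maxWorkload
  fun_prop

theorem measurableSet_lowLoad : MeasurableSet lowLoad := by
  have h1 : MeasurableSet orthant := by
    have : orthant = ⋂ i, {x : State | 0 ≤ x i} := by
      ext x
      simp [orthant]
    rw [this]
    exact MeasurableSet.iInter fun i => measurableSet_le measurable_const (measurable_pi_apply i)
  exact h1.inter (measurableSet_lt continuous_maxWorkload.measurable measurable_const)

theorem measurable_exp_L (α : ℝ) :
    Measurable fun x => ENNReal.ofReal (Real.exp (α * L x)) := by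
  have : Measurable L :=
    Measurable.ite measurableSet_lowLoad measurable_const continuous_maxWorkload.measurable
  fun_prop

theorem lintegral_exp_L_evolve_le (hα : 0 < α) {μ : Measure State}
    (hμ : ∀ᵐ x ∂μ, x ∈ orthant) (hY : IsNetInflow Y) (ht : 0 ≤ t) (hN : NetputLe Y t)
    (hz : ∀ i, 0 ≤ flow Y t z i ∧ flow Y t z i ≤ 3 / 2) :
    ∫⁻ x in lowLoadᶜ, ENNReal.ofReal (Real.exp (α * L x)) ∂(evolve Y μ t) ≤
      ENNReal.ofReal (Real.exp (α * (40 - t / 20))) * expMoment α μ := by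
  have hf : Measurable (flow Y t) := (continuous_flow hY ht).measurable
  rw [evolve, ← lintegral_indicator measurableSet_lowLoad.compl,
    lintegral_map ((measurable_exp_L α).indicator measurableSet_lowLoad.compl) hf, expMoment,
    ← lintegral_const_mul _ (measurable_exp_L α)]
  refine lintegral_mono_ae ?_
  filter_upwards [hμ] with x hx
  by_cases h : flow Y t x ∈ lowLoad
  · simp [h]
  · rw [Set.indicator_of_mem (Set.mem_compl h), ← ENNReal.ofReal_mul (Real.exp_nonneg _),
      ← Real.exp_add]
    refine ENNReal.ofReal_le_ofReal (Real.exp_le_exp.2 ?_)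
    have := L_flow_le hY ht hN hx hz h
    nlinarith

theorem expMoment_le_one_add {μ : Measure State} [IsProbabilityMeasure μ] (α : ℝ) :
    expMoment α μ ≤ 1 + ∫⁻ x in lowLoadᶜ, ENNReal.ofReal (Real.exp (α * L x)) ∂μ := by
  rw [expMoment, ← lintegral_add_compl _ measurableSet_lowLoad]
  gcongr
  calc ∫⁻ x in lowLoad, ENNReal.ofReal (Real.exp (α * L x)) ∂μ
      ≤ ∫⁻ _ in lowLoad, 1 ∂μ := by
        refine setLIntegral_mono measurable_const fun x hx => ?_
        rw [L, if_pos hx]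
        simp
    _ ≤ 1 := by
        rw [setLIntegral_one]
        exact prob_le_one

end Tail

/-! ### Uniform bounds and the conclusion. -/

/-- A uniform bound for the mean distance between the states of the network and the reference
trajectory at time `t`. -/
noncomputable def tailBound (α A t : ℝ) : ℝ := 150 / α * Real.exp (α * (19 - t / 20)) * (3 * A)

theorem tendsto_exp_mul_sub {α : ℝ} (hα : 0 < α) (b : ℝ) :
    Tendsto (fun t => Real.exp (α * (b - t / 20))) atTop (𝓝 0) := by
  refine Real.tendsto_exp_atBot.comp ?_
  have h : Tendsto (fun t : ℝ => t / 20 - b) atTop atTop :=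
    tendsto_atTop_add_const_right _ _ (tendsto_id.atTop_div_const (by norm_num))
  have h2 := tendsto_neg_atTop_atBot.comp (h.const_mul_atTop hα)
  refine h2.congr fun t => ?_
  simp only [Function.comp]
  ring

theorem tendsto_tailBound {α : ℝ} (hα : 0 < α) (A : ℝ) :
    Tendsto (tailBound α A) atTop (𝓝 0) := by
  have := ((tendsto_exp_mul_sub hα 19).const_mul (150 / α)).mul_const (3 * A)
  simp only [mul_zero, zero_mul] at this
  exact this

theorem tailBound_anti {α A : ℝ} (hα : 0 < α) (hA : 0 ≤ A) : Antitone (tailBound α A) := by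
  intro s t hst
  unfold tailBound
  gcongr

/-- Basic consequences of the hypotheses for the reference trajectory started from a point `z` of
the cycle close to the initial measure. -/
theorem reference_spec {α A : ℝ} (hα : 0 < α) {μ : Measure State} [IsProbabilityMeasure μ]
    (hμ : ∀ᵐ x ∂μ, x ∈ orthant) (hmass : ∫ x, (x .A + x .B + x .BA + x .AB + x .O) ∂μ = 1)
    (hexp : expMoment α μ < ENNReal.ofReal (3 * A)) {z : State} (hz : z ∈ cycle)
    (hkrov : krov μ (Measure.dirac z) < ENNReal.ofReal (1 / 10 ^ 12))
    {Y : Fluid → ℝ → ℝ} (hY : Y ∈ consistentInflows μ) :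
    0 < A ∧ (∀ i, Integrable (fun x : State => x i) μ) ∧
    IsAlmostClosed (1 / 10 ^ 9) Y (fun t => flow Y t z) ∧
    ∀ t, 0 ≤ t → NetputLe Y t ∧ ∫ x, rho (flow Y t x) (flow Y t z) ∂μ ≤ tailBound α A t := by
  have hA : 0 < A := by
    have := ENNReal.ofReal_pos.1 (bot_lt_of_lt hexp)
    linarith
  have hz0 := (mem_orthant_of_mem_cycle hz).1
  -- A non-integrable function has integral 0 by convention, so the mass condition carries
  -- integrability.
  have hsum : Integrable (fun x : State => x .A + x .B + x .BA + x .AB + x .O) μ :=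
    integrable_of_integral_eq_one hmass
  have hint : ∀ i, Integrable (fun x : State => x i) μ := by
    intro i
    refine hsum.mono' (measurable_pi_apply i).aestronglyMeasurable ?_
    filter_upwards [hμ] with x hx
    rw [Real.norm_eq_abs, abs_of_nonneg (hx i)]
    have h1 := hx .O
    have h2 := hx .A
    have h3 := hx .B
    have h4 := hx .AB
    have h5 := hx .BA
    cases i <;> linarith
  have h0 : ∫ x, rho x z ∂μ ≤ 1 / 10 ^ 12 := by
    have h1 := lintegral_rho_lt_of_krov_lt hkrov
    rw [← ofReal_integral_eq_lintegral_ofReal (integrable_rho hint z)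
      (ae_of_all _ fun x => rho_nonneg x z)] at h1
    exact (ENNReal.ofReal_lt_ofReal_iff'.1 h1).1.le
  -- The crude Lipschitz bound holds for all times and already gives the closure error 2 * 16 / 10 ^
  -- 12, which starts the bootstrap.
  have hclosed : IsAlmostClosed (1 / 10 ^ 9) Y (fun t => flow Y t z) := by
    have := isAlmostClosed_flow hint hmass hY hz0 le_rfl (η := 1 / 10 ^ 9) fun t ht => by
      have h2 : ∫ x, rho (flow Y t x) (flow Y t z) ∂μ ≤ ∫ x, 16 * rho x z ∂μ :=
        integral_mono (integrable_rho_flow hint hY.1 ht z) ((integrable_rho hint z).const_mul 16)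
          fun x => rho_flow_le hY.1 ht x z
      rw [integral_const_mul] at h2
      norm_num at h0 ⊢
      linarith
    simpa only [zero_add] using this
  refine ⟨hA, hint, hclosed, fun t ht => ?_⟩
  have hN : NetputLe Y t := hclosed.netput_le (by norm_num) le_rfl
    (by simpa only [flow_zero hY.1 hz0] using hz) hY.1.zero ht
  refine ⟨hN, ?_⟩
  have hC : 0 ≤ tailBound α A t := by unfold tailBound; positivity
  rw [← ENNReal.ofReal_le_ofReal_iff hC,
    ofReal_integral_eq_lintegral_ofReal (integrable_rho_flow hint hY.1 ht z)
      (ae_of_all _ fun x => rho_nonneg _ _)]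
  calc ∫⁻ x, ENNReal.ofReal (rho (flow Y t x) (flow Y t z)) ∂μ
      ≤ ∫⁻ x, ENNReal.ofReal (150 / α * Real.exp (α * (19 - t / 20))) *
          ENNReal.ofReal (Real.exp (α * L x)) ∂μ := by
        refine lintegral_mono_ae ?_
        filter_upwards [hμ] with x hx
        rw [← ENNReal.ofReal_mul (by positivity)]
        exact ENNReal.ofReal_le_ofReal (rho_flow_le_exp hα hY.1 ht hN hx hz)
    _ = ENNReal.ofReal (150 / α * Real.exp (α * (19 - t / 20))) * expMoment α μ :=
        lintegral_const_mul _ (measurable_exp_L α)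
    _ ≤ ENNReal.ofReal (150 / α * Real.exp (α * (19 - t / 20))) * ENNReal.ofReal (3 * A) := by
        gcongr
    _ = ENNReal.ofReal (tailBound α A t) := by
        rw [← ENNReal.ofReal_mul (by positivity), tailBound]

theorem krov_evolve_le {μ : Measure State} [IsProbabilityMeasure μ] {Y : Fluid → ℝ → ℝ}
    (hμ : ∀ i, Integrable (fun x : State => x i) μ) (hY : IsNetInflow Y) {t b d : ℝ} (ht : 0 ≤ t)
    {y z : State} (hb : ∫ x, rho (flow Y t x) (flow Y t y) ∂μ ≤ b)
    (hd : rho (flow Y t y) z ≤ d) :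
    krov (evolve Y μ t) (Measure.dirac z) ≤ ENNReal.ofReal (b + d) := by
  have hf : Measurable (flow Y t) := (continuous_flow hY ht).measurable
  have : IsProbabilityMeasure (evolve Y μ t) := Measure.isProbabilityMeasure_map hf.aemeasurable
  refine (krov_dirac_le _ z).trans ?_
  rw [evolve, lintegral_map (continuous_rho_right z).measurable.ennreal_ofReal hf]
  have hi := integrable_rho_flow hμ hY ht y
  calc ∫⁻ x, ENNReal.ofReal (rho (flow Y t x) z) ∂μ
      ≤ ∫⁻ x, ENNReal.ofReal (rho (flow Y t x) (flow Y t y) + d) ∂μ :=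
        lintegral_mono fun x => ENNReal.ofReal_le_ofReal
          ((rho_triangle _ (flow Y t y) _).trans (by linarith))
    _ = ENNReal.ofReal (∫ x, (rho (flow Y t x) (flow Y t y) + d) ∂μ) :=
        (ofReal_integral_eq_lintegral_ofReal (hi.add (integrable_const d)) (ae_of_all _ fun x =>
          add_nonneg (rho_nonneg _ _) ((rho_nonneg _ _).trans hd))).symm
    _ ≤ ENNReal.ofReal (b + d) := by
        refine ENNReal.ofReal_le_ofReal ?_
        rw [integral_add hi (integrable_const d)]
        simpa using hb

end FluidNetwork

theorem proposition4p6 (α : ℝ) (hα : 0 < α) (A : ℝ) :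
    ∃ ε : ℝ, 0 < ε ∧ ∃ r : ℝ → ℝ≥0∞, Tendsto r atTop (𝓝 0) ∧
      ∀ μ₀ : Measure State, IsProbabilityMeasure μ₀ → (∀ᵐ x ∂μ₀, x ∈ orthant) →
        ∫ x, (x .A + x .B + x .BA + x .AB + x .O) ∂μ₀ = 1 →
        expMoment α μ₀ < ENNReal.ofReal (3 * A) →
        (∃ x ∈ cycle, krov μ₀ (Measure.dirac x) < ENNReal.ofReal ε) →
        ∀ Y ∈ consistentInflows μ₀,
          (∃ z : ℝ → State, ∀ t, 0 ≤ t →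
            z t ∈ cycle ∧ krov (evolve Y μ₀ t) (Measure.dirac (z t)) ≤ r t) ∧
          (∀ t, 0 ≤ t →
            ∫⁻ x in lowLoadᶜ, ENNReal.ofReal (Real.exp (α * L x)) ∂(evolve Y μ₀ t) ≤ r t ∧
            expMoment α (evolve Y μ₀ t) ≤ 1 + r t) := by
  obtain ⟨T, hT⟩ : ∃ T, ∀ t, T ≤ t → 2 * tailBound α A t < 1 / 10 ^ 9 := by
    have h := (tendsto_tailBound hα A).const_mul 2
    rw [mul_zero] at h
    exact eventually_atTop.1 (h.eventually (gt_mem_nhds (by norm_num)))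
  -- One rate for both claims: the first summand serves I, the second II. The value is infinite
  -- until the closure error is below `1 / 10 ^ 9` and 5 more time units have passed, as
  -- `nearCycle_of_improved` needs.
  let r : ℝ → ℝ≥0∞ := fun t => if t < max T 0 + 5 then ⊤ else
    ENNReal.ofReal (tailBound α A t + 10 ^ 8 * (2 * tailBound α A (t - 5))) +
      ENNReal.ofReal (Real.exp (α * (40 - t / 20))) * ENNReal.ofReal (3 * A)
  have hr : Tendsto r atTop (𝓝 0) := by
    have h1 : Tendsto (fun t => tailBound α A t + 10 ^ 8 * (2 * tailBound α A (t - 5))) atTop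
        (𝓝 0) := by
      have h2 := (tendsto_tailBound hα A).comp (tendsto_atTop_add_const_right atTop (-5) tendsto_id)
      have := (tendsto_tailBound hα A).add ((h2.const_mul 2).const_mul (10 ^ 8))
      simpa [Function.comp_def, sub_eq_add_neg] using this
    have h3 := ENNReal.tendsto_ofReal h1
    have h4 := ENNReal.Tendsto.mul_const (b := ENNReal.ofReal (3 * A))
      (ENNReal.tendsto_ofReal (tendsto_exp_mul_sub hα 40)) (Or.inr ENNReal.ofReal_ne_top)
    have h5 := h3.add h4
    simp only [ENNReal.ofReal_zero, zero_mul, add_zero] at h5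
    refine h5.congr' ?_
    filter_upwards [eventually_ge_atTop (max T 0 + 5)] with t ht
    exact (if_neg (not_lt.2 ht)).symm
  -- The radius is independent of `α` and `A`, which affect only the rate.
  refine ⟨1 / 10 ^ 12, by norm_num, r, hr, ?_⟩
  rintro μ hprob hμ hmass hexp ⟨z₀, hz₀, hkrov⟩ Y hY
  obtain ⟨hA, hint, hclosed, hspec⟩ := reference_spec hα hμ hmass hexp hz₀ hkrov hY
  have hz₀' := (mem_orthant_of_mem_cycle hz₀).1
  have hstart : flow Y 0 z₀ ∈ cycle := by rwa [flow_zero hY.1 hz₀']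
  constructor
  · have hex : ∀ t, 0 ≤ t → ∃ z ∈ cycle, krov (evolve Y μ t) (Measure.dirac z) ≤ r t := by
      intro t ht
      by_cases hlt : t < max T 0 + 5
      · exact ⟨z₀, hz₀, by simp [r, hlt]⟩
      have hT0 := le_max_left T 0
      have h00 := le_max_right T 0
      have ha : 0 ≤ t - 5 := by linarith
      have hg := isAlmostClosed_flow hint hmass hY hz₀' ha (η := 2 * tailBound α A (t - 5))
        fun s hs => by
          have h1 := (hspec s (ha.trans hs)).2
          have h2 := tailBound_anti hα hA.le hs
          linarith
      obtain ⟨z, hz, hd⟩ := hclosed.nearCycle_of_improved (t := t) (by norm_num) le_rfl hstart ha hg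
        (by unfold tailBound; positivity) (hT _ (by linarith)).le (by linarith)
      refine ⟨z, hz, (krov_evolve_le hint hY.1 ht (hspec t ht).2 hd).trans ?_⟩
      simp only [r, if_neg hlt]
      exact le_self_add
    choose! z hz using hex
    exact ⟨z, hz⟩
  · intro t ht
    have hprob' : IsProbabilityMeasure (evolve Y μ t) :=
      Measure.isProbabilityMeasure_map (continuous_flow hY.1 ht).measurable.aemeasurable
    have hle : ∫⁻ x in lowLoadᶜ, ENNReal.ofReal (Real.exp (α * L x)) ∂(evolve Y μ t) ≤ r t := by
      have hbd : ∀ i, 0 ≤ flow Y t z₀ i ∧ flow Y t z₀ i ≤ 3 / 2 := by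
        have h0 := flow_mem_orthant hY.1 ht hz₀'
        have h1 := (abs_le.1 (hclosed.mass ht)).2
        norm_num at h1
        have := h0 .O
        have := h0 .A
        have := h0 .B
        have := h0 .AB
        have := h0 .BA
        intro i
        refine ⟨h0 i, ?_⟩
        cases i <;> linarith
      have h1 := lintegral_exp_L_evolve_le hα hμ hY.1 ht (hspec t ht).1 hbd
      by_cases hlt : t < max T 0 + 5
      · simp [r, hlt]
      · simp only [r, if_neg hlt]
        refine (h1.trans ?_).trans le_add_self
        gcongr
    exact ⟨hle, (expMoment_le_one_add α).trans (by gcongr)⟩
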